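/- Let $\Omega=\{\omega\in C(\mathbb R,\mathbb R):\omega(0)=0\}$ carry the $\sigma$-algebra generated by the evaluations and the two-sided Wiener measure $\mathbb P$, and let $\theta_t\omega(s)=\omega(s+t)-\omega(t)$ for $s,t\in\mathbb R$. For $\gamma\in\mathbb R$ and $\lambda>0$ put $$O^\lambda(\omega)=-\int_{-\infty}^0\gamma\lambda e^{\lambda s}\omega(s)\,ds ,$$ so that $O^\lambda(\theta_t\omega)$ is the stationary Ornstein--Uhlenbeck process solving $dO=-\lambda O\,dt+\gamma\,dW_t$ (on the shift-invariant $\mathbb P$-null set of paths for which the integral does not converge, put $O^\lambda=0$). For $\rho\in\mathbb R$ and $\beta,\sigma>0$ consider the random differential equation on $\mathbb R^3$ $$\dot x=\sigma(y-x),\qquad \dot y=(\rho-O^\lambda(\theta_t\omega))x-y-xz,\qquad \dot z=-\beta z+xy-(\beta-\lambda)O^\lambda(\theta_t\omega),$$ which is the Lorenz system with additive noise $\gamma\,dW_t$ in its third component $Z$, written in the variable $z=Z-O^\lambda(\theta_t\omega)$. A pullback attractor of a random dynamical system $\varphi$ over $\theta$ is a random nonempty compact set $A$ (that is, $A(\omega)$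 is nonempty and compact and $\omega\mapsto d(v,A(\omega))$ is measurable for every point $v$) such that for every $t\ge0$ one has $\varphi_t(\omega,A(\omega))=A(\theta_t\omega)$ for almost every $\omega$, and such that for every compact $B\subset\mathbb R^3$ one has $\lim_{t\to\infty}\sup_{v\in B}d(\varphi_t(\theta_{-t}\omega,v),A(\omega))=0$ for almost every $\omega$. **Lemma.** For all $\gamma,\rho\in\mathbb R$, all $\beta,\sigma>0$ and all $\lambda>0$, the equation has, for every $\omega$ and every initial point, a unique solution on $[0,\infty)$; its solution map $\varphi$ is a random dynamical system over the measure-preserving flow $(\Omega,\mathbb P,\theta)$ (a jointly measurable perfect cocycle, continuous in the initial point); and $\varphi$ has a pullback attractor, which is unique up to $\mathbb P$-null sets. -/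

import Mathlib

open MeasureTheory ProbabilityTheory Filter Topology Set
open scoped NNReal ENNReal

/-! ### The two-sided Wiener space and its shift -/

/-- The canonical path space: continuous functions `ω : ℝ → ℝ` with `ω 0 = 0`. -/
def PathSpace : Type := {ω : C(ℝ, ℝ) // ω 0 = 0}

namespace PathSpace

instance : CoeFun PathSpace (fun _ => ℝ → ℝ) := ⟨fun ω => ω.1⟩

/-- The σ-algebra generated by the evaluations `ω ↦ ω t`, which is also the Borel σ-algebra of
locally uniform convergence. -/
instance : MeasurableSpace PathSpace :=
  MeasurableSpace.comap (fun (ω : PathSpace) (t : ℝ) => ω t) MeasurableSpace.pi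

/-- The Wiener shift `(θ_t ω)(s) = ω (s + t) - ω t`. -/
def shift (t : ℝ) (ω : PathSpace) : PathSpace :=
  ⟨⟨fun s => ω (s + t) - ω t, by
      exact (ω.1.continuous.comp (continuous_id.add continuous_const)).sub continuous_const⟩,
    by simp⟩

end PathSpace

/-- `P` is the two-sided Wiener measure: under `P` the coordinate process is a standard Brownian
motion indexed by `ℝ` (continuous and null at `0` by the choice of the space). These properties
determine `P` uniquely. -/
structure IsWienerMeasure (P : Measure PathSpace) : Prop where
  isProbabilityMeasure : IsProbabilityMeasure P
  increment_law : ∀ s t : ℝ, s ≤ t →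
    HasLaw (fun ω : PathSpace => ω t - ω s) (gaussianReal 0 (t - s).toNNReal) P
  indep_increments : HasIndepIncrements (fun (t : ℝ) (ω : PathSpace) => ω t) P

/-! ### Random dynamical systems and pullback attractors -/

section RDS

variable {Ω E : Type*} [MeasurableSpace Ω]

/-- `θ` is a measurable flow on `Ω` preserving the probability measure `P`. -/
structure IsMetricDynamicalSystem (P : Measure Ω) (θ : ℝ → Ω → Ω) : Prop where
  isProbabilityMeasure : IsProbabilityMeasure P
  measurable : Measurable fun p : ℝ × Ω => θ p.1 p.2
  map_zero : ∀ ω, θ 0 ω = ω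
  map_add : ∀ s t ω, θ (t + s) ω = θ t (θ s ω)
  measurePreserving : ∀ t, MeasurePreserving (θ t) P P

/-- `φ` is a random dynamical system over `θ`: a measurable perfect cocycle, defined for
nonnegative times and continuous in space. -/
structure IsRDS [TopologicalSpace E] [MeasurableSpace E] (P : Measure Ω) (θ : ℝ → Ω → Ω)
    (φ : ℝ≥0 → Ω → E → E) : Prop where
  base : IsMetricDynamicalSystem P θ
  measurable : Measurable fun p : ℝ≥0 × Ω × E => φ p.1 p.2.1 p.2.2
  map_zero : ∀ ω x, φ 0 ω x = x
  cocycle : ∀ (s t : ℝ≥0) ω x, φ (t + s) ω x = φ t (θ s ω) (φ s ω x)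
  continuous : ∀ (t : ℝ≥0) ω, Continuous (φ t ω)

variable [PseudoMetricSpace E]

/-- A random compact set: nonempty compact values, with `ω ↦ d(x, A(ω))` measurable for all `x`. -/
structure IsRandomCompactSet (A : Ω → Set E) : Prop where
  nonempty : ∀ ω, (A ω).Nonempty
  isCompact : ∀ ω, IsCompact (A ω)
  measurable_infDist : ∀ x : E, Measurable fun ω => Metric.infDist x (A ω)

/-- A (global) pullback attractor of `φ`: an invariant random compact set `A` such that, for each
compact `B`, almost surely `sup_{x ∈ B} d(φ_t(θ_{-t} ω, x), A(ω)) → 0` as `t → ∞`. -/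
structure IsPullbackAttractor (P : Measure Ω) (θ : ℝ → Ω → Ω) (φ : ℝ≥0 → Ω → E → E)
    (A : Ω → Set E) : Prop where
  randomCompact : IsRandomCompactSet A
  invariant : ∀ t : ℝ≥0, ∀ᵐ ω ∂P, φ t ω '' A ω = A (θ t ω)
  attracts : ∀ B : Set E, IsCompact B → ∀ᵐ ω ∂P,
    Tendsto (fun t : ℝ≥0 => ⨆ x ∈ B, Metric.infEDist (φ t (θ (-(t : ℝ)) ω) x) (A ω)) atTop (𝓝 0)

end RDS

/-! ### The transformed Lorenz system -/

noncomputable section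

/-- The Ornstein–Uhlenbeck variable
`O(ω) = ∫_{-∞}^0 γ e^{λ s} dW_s = - ∫_{-∞}^0 γ λ e^{λ s} ω(s) ds`. The set of paths for which the
integral converges has full Wiener measure and is invariant under the shift; off this set the
integral is `0` by convention. -/
def ouVar (γ lam : ℝ) (ω : PathSpace) : ℝ :=
  -∫ s in Iic (0 : ℝ), γ * lam * Real.exp (lam * s) * ω s

/-- The right-hand side of the Lorenz system in the variables `(x, y, z) = (v 0, v 1, v 2)`, where
`z` is the third Lorenz coordinate minus the Ornstein–Uhlenbeck value `o`. -/
def lorenzField (σ β ρ lam o : ℝ) (v : EuclideanSpace ℝ (Fin 3)) : EuclideanSpace ℝ (Fin 3) :=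
  !₂[σ * (v 1 - v 0),
     (ρ - o) * v 0 - v 1 - v 0 * v 2,
     -β * v 2 + v 0 * v 1 - (β - lam) * o]

/-- `φ` is the solution map of the transformed Lorenz system: for every path `ω` and initial point
`v`, the curve `t ↦ φ t ω v` starts at `v` and solves the (pathwise) equation for all `t ≥ 0`, with
`O_t(ω) = O(θ_t ω)`. -/
def IsLorenzSolutionMap (σ β ρ γ lam : ℝ)
    (φ : ℝ≥0 → PathSpace → EuclideanSpace ℝ (Fin 3) → EuclideanSpace ℝ (Fin 3)) : Prop :=
  ∀ ω v, φ 0 ω v = v ∧ ∀ t : ℝ≥0,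
    HasDerivWithinAt (fun r : ℝ => φ r.toNNReal ω v)
      (lorenzField σ β ρ lam (ouVar γ lam (PathSpace.shift t ω)) (φ t ω v)) (Ici 0) t

end

/-! ### Elementary estimates for the Lorenz field -/

section LorenzField

variable {σ β ρ lam : ℝ}

/-! The energy is the squared distance to `(0, 0, c)` with `c = σ + ρ`. This choice of `c` cancels
every deterministic `xy` term, so along trajectories driven by `o` the only quadratic noise term is
`-2oxy`. With `κ = min σ (min 1 β)`, the energy obeys a linear differential inequality with rate
`-κ/2 + o²/(2κ)` and forcing quadratic in `o`. It cannot explode, which gives global solutions.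
Lipschitz dependence on the data then gives uniqueness, the cocycle property and joint continuity in
driver, time and initial point. Measurability follows because the Ornstein–Uhlenbeck path is a
measurable random element of `C(ℝ, ℝ)`.

For pullback absorption this rate must be negative on average. With `o` the stationary process the
average need not be negative, since the mean of `O²` can be large. The remedy
(`exists_cell_energy_le`) is to cut time into cells of length `h` and to use, in each cell, the
third coordinate `Z` minus the noise increment since the start of that cell. In this variable the
system is again a Lorenz system, with `lam = 0` and driver `γω`, which starts from zero in every
cell. The mean of `∫ (γω)²` over a cell is `γ²h²/2`, quadratic in `h`, whereas the dissipation is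
linear in `h`. Short cells therefore contract on average for all parameters. Returning to `Z` at the
end of a cell costs half of the dissipation and a square of the increment.

This gives a one-step inequality `V ↦ exp(a) V + exp(g) - 1` with `E a < 0`. The `a` of different
cells are independent, so their sums have negative linear slope by the strong law. The exponent `g`
grows sublinearly along the past by Borel–Cantelli, which requires only an integrable `g`. The
stationary solution `r = stationaryRadius` of `r ↦ exp(a) r + exp(g)` is a convergent series. The
ball of squared radius `r` about `c` in the `Z` variable is almost surely mapped into itself after
one cell, and the slack `-1` lets it absorb compact sets exactly, not just up to an error.

A general theorem (`IsRDS.exists_isPullbackAttractor`) then takes `A` to be the decreasing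
intersection of the images of the past balls. Compactness gives attraction and invariance at the
cell time. Poincaré recurrence (`IsRDS.ae_subset_of_attracts`) supplies the rest: an invariant
random set returns infinitely often in the past to a fixed bounded region, so it lies in every
closed random set that attracts balls. This yields both invariance at arbitrary times and
uniqueness. -/

lemma lorenzField_zero (o : ℝ) (v : EuclideanSpace ℝ (Fin 3)) :
    lorenzField σ β ρ lam o v 0 = σ * (v 1 - v 0) := rfl

lemma lorenzField_one (o : ℝ) (v : EuclideanSpace ℝ (Fin 3)) :
    lorenzField σ β ρ lam o v 1 = (ρ - o) * v 0 - v 1 - v 0 * v 2 := rfl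

lemma lorenzField_two (o : ℝ) (v : EuclideanSpace ℝ (Fin 3)) :
    lorenzField σ β ρ lam o v 2 = -β * v 2 + v 0 * v 1 - (β - lam) * o := rfl

lemma EuclideanSpace.norm_le_abs_add_abs_add_abs (v : EuclideanSpace ℝ (Fin 3)) :
    ‖v‖ ≤ |v 0| + |v 1| + |v 2| := by
  rw [EuclideanSpace.norm_eq]
  apply Real.sqrt_le_iff.2 ⟨by positivity, ?_⟩
  simp only [Fin.sum_univ_three, Real.norm_eq_abs]
  nlinarith [abs_nonneg (v 0), abs_nonneg (v 1), abs_nonneg (v 2),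
    mul_nonneg (abs_nonneg (v 0)) (abs_nonneg (v 1)),
    mul_nonneg (abs_nonneg (v 0)) (abs_nonneg (v 2)),
    mul_nonneg (abs_nonneg (v 1)) (abs_nonneg (v 2))]

lemma EuclideanSpace.abs_apply_le_norm {ι : Type*} [Fintype ι] (v : EuclideanSpace ℝ ι) (i : ι) :
    |v i| ≤ ‖v‖ := by
  simpa using PiLp.norm_apply_le v i

/-- The Lorenz field is Lipschitz on bounded sets, jointly in the noise and the point. -/
lemma exists_norm_lorenzField_sub_le (σ β ρ lam M : ℝ) :
    ∃ K : ℝ, 1 ≤ K ∧ ∀ o o' : ℝ, ∀ v v' : EuclideanSpace ℝ (Fin 3), |o| ≤ M → ‖v‖ ≤ M → ‖v'‖ ≤ M →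
      ‖lorenzField σ β ρ lam o v - lorenzField σ β ρ lam o' v'‖ ≤ K * (|o - o'| + ‖v - v'‖) := by
  refine ⟨1 + 2 * |σ| + |ρ| + |M| + 1 + 2 * |M| + |β| + 2 * |M| + |β - lam| + |M|, ?_, ?_⟩
  · have := abs_nonneg σ; have := abs_nonneg ρ; have := abs_nonneg M; have := abs_nonneg β
    have := abs_nonneg (β - lam); linarith
  intro o o' v v' ho hv hv'
  -- `M` is arbitrary, but the bound on `o` forces it to be nonnegative; the constant uses `|M|` so
  -- that it is at least `1` unconditionally.
  have hM : M = |M| := (abs_of_nonneg ((abs_nonneg o).trans ho)).symm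
  have e0 := EuclideanSpace.abs_apply_le_norm (v - v') 0
  have e1 := EuclideanSpace.abs_apply_le_norm (v - v') 1
  have e2 := EuclideanSpace.abs_apply_le_norm (v - v') 2
  have a0 := (EuclideanSpace.abs_apply_le_norm v 0).trans hv
  have b0 := (EuclideanSpace.abs_apply_le_norm v' 0).trans hv'
  have b1 := (EuclideanSpace.abs_apply_le_norm v' 1).trans hv'
  have b2 := (EuclideanSpace.abs_apply_le_norm v' 2).trans hv'
  simp only [PiLp.sub_apply] at e0 e1 e2
  refine (EuclideanSpace.norm_le_abs_add_abs_add_abs _).trans ?_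
  simp only [PiLp.sub_apply, lorenzField_zero, lorenzField_one, lorenzField_two]
  set d := ‖v - v'‖
  set η := |o - o'|
  have hη : 0 ≤ η := abs_nonneg _
  have hd : 0 ≤ d := norm_nonneg _
  rw [hM] at a0 b0 b1 b2 ho
  set m := |M|
  have hm : 0 ≤ m := abs_nonneg _
  have key : ∀ {a b A B : ℝ}, |a| ≤ A → |b| ≤ B → |a * b| ≤ A * B := fun ha hb => by
    rw [abs_mul]; exact mul_le_mul ha hb (abs_nonneg _) ((abs_nonneg _).trans ha)
  have t0 : |σ * (v 1 - v 0) - σ * (v' 1 - v' 0)| ≤ 2 * |σ| * d := by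
    have : σ * (v 1 - v 0) - σ * (v' 1 - v' 0) = σ * (v 1 - v' 1) - σ * (v 0 - v' 0) := by ring
    rw [this]
    refine (abs_sub _ _).trans ?_
    linarith [key (le_refl |σ|) e1, key (le_refl |σ|) e0]
  have t1 : |(ρ - o) * v 0 - v 1 - v 0 * v 2 - ((ρ - o') * v' 0 - v' 1 - v' 0 * v' 2)|
      ≤ |ρ| * d + m * d + m * η + d + m * d + m * d := by
    have : (ρ - o) * v 0 - v 1 - v 0 * v 2 - ((ρ - o') * v' 0 - v' 1 - v' 0 * v' 2)
      = ρ * (v 0 - v' 0) + -(o * (v 0 - v' 0)) + -(v' 0 * (o - o')) + -(v 1 - v' 1)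
        + -(v 0 * (v 2 - v' 2)) + -(v' 2 * (v 0 - v' 0)) := by ring
    rw [this]
    have h1 := key (le_refl |ρ|) e0
    have h2 := key ho e0
    have h3 := key b0 (le_refl η)
    have h4 := key a0 e2
    have h5 := key b2 e0
    refine (abs_add_le _ _).trans (add_le_add ((abs_add_le _ _).trans (add_le_add
      ((abs_add_le _ _).trans (add_le_add ((abs_add_le _ _).trans (add_le_add
      ((abs_add_le _ _).trans (add_le_add h1 ?_)) ?_)) ?_)) ?_)) ?_) <;> rwa [abs_neg]
  have t2 : |-β * v 2 + v 0 * v 1 - (β - lam) * o - (-β * v' 2 + v' 0 * v' 1 - (β - lam) * o')|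
      ≤ |β| * d + m * d + m * d + |β - lam| * η := by
    have : -β * v 2 + v 0 * v 1 - (β - lam) * o - (-β * v' 2 + v' 0 * v' 1 - (β - lam) * o')
      = -(β * (v 2 - v' 2)) + v 0 * (v 1 - v' 1) + v' 1 * (v 0 - v' 0)
        + -((β - lam) * (o - o')) := by ring
    rw [this]
    have h1 := key (le_refl |β|) e2
    have h2 := key a0 e1
    have h3 := key b1 e0
    have h4 := key (le_refl |β - lam|) (le_refl η)
    refine (abs_add_le _ _).trans (add_le_add ((abs_add_le _ _).trans (add_le_add
      ((abs_add_le _ _).trans (add_le_add ?_ h2)) h3)) ?_) <;> rwa [abs_neg]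
  have hsum := add_le_add (add_le_add t0 t1) t2
  refine hsum.trans ?_
  have := abs_nonneg σ; have := abs_nonneg ρ; have := abs_nonneg β; have := abs_nonneg (β - lam)
  have h1 : 0 ≤ |σ| * η := by positivity
  have h2 : 0 ≤ |ρ| * η := by positivity
  have h3 : 0 ≤ |β| * η := by positivity
  have h4 : 0 ≤ |β - lam| * d := by positivity
  have h5 : 0 ≤ m * η := by positivity
  have h6 : 0 ≤ m * d := by positivity
  nlinarith

lemma continuous_lorenzField :
    Continuous fun p : ℝ × EuclideanSpace ℝ (Fin 3) => lorenzField σ β ρ lam p.1 p.2 := by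
  unfold lorenzField
  refine (PiLp.continuous_toLp 2 _).comp (continuous_pi fun i => ?_)
  fin_cases i <;> simp <;> fun_prop

/-- The squared distance to the point `(0, 0, c)`. -/
def lorenzEnergy (c : ℝ) (v : EuclideanSpace ℝ (Fin 3)) : ℝ := v 0 ^ 2 + v 1 ^ 2 + (v 2 - c) ^ 2

lemma lorenzEnergy_nonneg (c : ℝ) (v : EuclideanSpace ℝ (Fin 3)) : 0 ≤ lorenzEnergy c v := by
  unfold lorenzEnergy; positivity

lemma lorenzEnergy_eq (c : ℝ) (v : EuclideanSpace ℝ (Fin 3)) :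
    lorenzEnergy c v = ‖v - !₂[0, 0, c]‖ ^ 2 := by
  rw [EuclideanSpace.norm_sq_eq]
  simp [Fin.sum_univ_three, lorenzEnergy]

lemma norm_sq_eq_three (v : EuclideanSpace ℝ (Fin 3)) :
    ‖v‖ ^ 2 = v 0 ^ 2 + v 1 ^ 2 + v 2 ^ 2 := by
  rw [EuclideanSpace.norm_sq_eq]
  simp [Fin.sum_univ_three]

lemma lorenzEnergy_le (c : ℝ) (v : EuclideanSpace ℝ (Fin 3)) :
    lorenzEnergy c v ≤ 2 * ‖v‖ ^ 2 + 2 * c ^ 2 := by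
  rw [norm_sq_eq_three, lorenzEnergy]
  nlinarith [sq_nonneg (v 2 + c), sq_nonneg (v 0), sq_nonneg (v 1)]

lemma norm_sq_le_lorenzEnergy (c : ℝ) (v : EuclideanSpace ℝ (Fin 3)) :
    ‖v‖ ^ 2 ≤ 2 * lorenzEnergy c v + 2 * c ^ 2 := by
  rw [norm_sq_eq_three, lorenzEnergy]
  nlinarith [sq_nonneg (v 2 - c - c), sq_nonneg (v 0), sq_nonneg (v 1)]

/-- The forcing term in the energy inequality. -/
noncomputable def energyForcing (σ β ρ lam κ o : ℝ) : ℝ :=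
  (2 * β ^ 2 * (σ + ρ) ^ 2 + 2 * (β - lam) ^ 2 * o ^ 2) / κ

lemma energyForcing_nonneg {κ : ℝ} (hκ : 0 < κ) (o : ℝ) :
    0 ≤ energyForcing σ β ρ lam κ o := by
  unfold energyForcing; positivity

lemma continuous_energyForcing {κ : ℝ} : Continuous (energyForcing σ β ρ lam κ) := by
  unfold energyForcing; fun_prop

/-- The energy inequality of the Lorenz system. -/
lemma lorenzField_energy_le {κ : ℝ} (hκ : 0 < κ) (hκσ : κ ≤ σ) (hκ1 : κ ≤ 1) (hκβ : κ ≤ β)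
    (o : ℝ) (v : EuclideanSpace ℝ (Fin 3)) :
    2 * v 0 * lorenzField σ β ρ lam o v 0 + 2 * v 1 * lorenzField σ β ρ lam o v 1
      + 2 * (v 2 - (σ + ρ)) * lorenzField σ β ρ lam o v 2
      ≤ (-(κ / 2) + o ^ 2 / (2 * κ)) * lorenzEnergy (σ + ρ) v
        + energyForcing σ β ρ lam κ o := by
  rw [lorenzField_zero, lorenzField_one, lorenzField_two, lorenzEnergy, energyForcing]
  generalize v 0 = x
  generalize v 1 = y
  obtain ⟨w, hw⟩ : ∃ w, v 2 = w + (σ + ρ) := ⟨v 2 - (σ + ρ), by ring⟩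
  rw [hw, add_sub_cancel_right]
  set c := σ + ρ with hc
  have hρ : ρ = c - σ := by rw [hc]; ring
  rw [hρ]
  -- Two applications of Young's inequality: `2|xy| ≤ x² + y²`, then `|o| ≤ κ/2 + o²/(2κ)`, which
  -- spends only part of the dissipation `2κ`.
  have e1 : -(2 * o * x * y) ≤ (κ / 2 + o ^ 2 / (2 * κ)) * (x ^ 2 + y ^ 2) := by
    have h : |o| ≤ κ / 2 + o ^ 2 / (2 * κ) := by
      rw [div_add_div _ _ (by norm_num) (by positivity), le_div_iff₀ (by positivity), ← sq_abs o]
      nlinarith [sq_nonneg (|o| - κ)]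
    have h2 : -(2 * o * x * y) ≤ |o| * (x ^ 2 + y ^ 2) := by
      rcases abs_cases o with ⟨h, h'⟩ | ⟨h, h'⟩ <;> rw [h]
      · nlinarith [mul_nonneg h' (sq_nonneg (x + y))]
      · nlinarith [mul_nonneg (neg_nonneg.2 h'.le) (sq_nonneg (x - y))]
    exact h2.trans (mul_le_mul_of_nonneg_right h (by positivity))
  have e2 : -(2 * w * (β * c)) + -(2 * w * ((β - lam) * o)) ≤
      κ * w ^ 2 + (2 * β ^ 2 * c ^ 2 + 2 * (β - lam) ^ 2 * o ^ 2) / κ := by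
    rw [← sub_le_iff_le_add', le_div_iff₀ hκ]
    nlinarith [sq_nonneg (κ * w + β * c + (β - lam) * o), sq_nonneg (β * c - (β - lam) * o)]
  have e3 : 0 ≤ o ^ 2 / (2 * κ) * w ^ 2 := by positivity
  nlinarith [mul_nonneg (sub_nonneg.2 hκσ) (sq_nonneg x), mul_nonneg (sub_nonneg.2 hκ1) (sq_nonneg y),
    mul_nonneg (sub_nonneg.2 hκβ) (sq_nonneg w), mul_nonneg hκ.le (sq_nonneg w)]

lemma hasDerivWithinAt_lorenzEnergy {c : ℝ} {u : ℝ → EuclideanSpace ℝ (Fin 3)}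
    {u' : EuclideanSpace ℝ (Fin 3)} {s : Set ℝ} {t : ℝ} (hu : HasDerivWithinAt u u' s t) :
    HasDerivWithinAt (fun r => lorenzEnergy c (u r))
      (2 * u t 0 * u' 0 + 2 * u t 1 * u' 1 + 2 * (u t 2 - c) * u' 2) s t := by
  have h : ∀ i, HasDerivWithinAt (fun r => u r i) (u' i) s t := fun i =>
    (EuclideanSpace.proj (𝕜 := ℝ) i).hasFDerivAt.comp_hasDerivWithinAt t hu
  unfold lorenzEnergy
  convert! (((h 0).pow 2).add ((h 1).pow 2)).add (((h 2).sub_const c).pow 2) using 1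
  simp

end LorenzField

/-- **Grönwall's inequality** with variable coefficients. -/
lemma le_exp_mul_add_of_hasDerivWithinAt_le {T k : ℝ} (hT : 0 ≤ T) (hk : 0 ≤ k) {V V' q g : ℝ → ℝ}
    (hq : Continuous q) (hg : Continuous g) (hq0 : ∀ t, 0 ≤ q t) (hg0 : ∀ t, 0 ≤ g t)
    (hV : ∀ t ∈ Icc 0 T, HasDerivWithinAt V (V' t) (Icc 0 T) t)
    (hle : ∀ t ∈ Icc 0 T, V' t ≤ (-k + q t) * V t + g t) :
    V T ≤ Real.exp (-k * T + ∫ s in (0)..T, q s) * V 0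
      + Real.exp (∫ s in (0)..T, q s) * ∫ s in (0)..T, g s := by
  -- `E` is the integrating factor; the hypothesis says that `V E - ∫ E g` is nonincreasing.
  set E : ℝ → ℝ := fun t => Real.exp (k * t - ∫ s in (0)..t, q s) with hE
  have hQd : ∀ t, HasDerivAt (fun t => ∫ s in (0)..t, q s) (q t) t := fun t =>
    intervalIntegral.integral_hasDerivAt_right (hq.intervalIntegrable _ _)
      (hq.stronglyMeasurableAtFilter _ _) hq.continuousAt
  have hEd : ∀ t, HasDerivAt E (E t * (k - q t)) t := fun t => by
    have := (((hasDerivAt_id t).const_mul k).sub (hQd t)).exp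
    simpa [hE] using this
  have hEc : Continuous E := continuous_iff_continuousAt.2 fun t => (hEd t).continuousAt
  have hGd : ∀ t, HasDerivAt (fun t => ∫ s in (0)..t, E s * g s) (E t * g t) t := fun t =>
    intervalIntegral.integral_hasDerivAt_right ((hEc.mul hg).intervalIntegrable _ _)
      ((hEc.mul hg).stronglyMeasurableAtFilter _ _) (hEc.mul hg).continuousAt
  have hanti : AntitoneOn (fun t => V t * E t - ∫ s in (0)..t, E s * g s) (Icc 0 T) := by
    refine antitoneOn_of_hasDerivWithinAt_nonpos (convex_Icc 0 T)
      (f' := fun t => V' t * E t + V t * (E t * (k - q t)) - E t * g t) ?_ ?_ ?_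
    · intro t ht
      exact (((hV t ht).mul (hEd t).hasDerivWithinAt).sub
        (hGd t).hasDerivWithinAt).continuousWithinAt
    · intro t ht
      have ht' := interior_subset ht
      exact (((hV t ht').mul (hEd t).hasDerivWithinAt).sub
        (hGd t).hasDerivWithinAt).mono interior_subset
    · intro t ht
      have h1 := hle t (interior_subset ht)
      have h2 : 0 < E t := Real.exp_pos _
      nlinarith [mul_le_mul_of_nonneg_left h1 h2.le]
  have h0 := hanti (left_mem_Icc.2 hT) (right_mem_Icc.2 hT) hT
  simp only [intervalIntegral.integral_same, sub_zero] at h0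
  have hE0 : E 0 = 1 := by simp [hE]
  rw [hE0, mul_one] at h0
  have hET : 0 < E T := Real.exp_pos _
  -- For `s ≤ T` one has `E s ≤ exp (k T)`, and `exp (k T)` equals `E T * exp (∫ q)` over `[0, T]`.
  have hint : ∫ s in (0)..T, E s * g s ≤ E T * (Real.exp (∫ s in (0)..T, q s) * ∫ s in (0)..T, g s) := by
    rw [← intervalIntegral.integral_const_mul, ← intervalIntegral.integral_const_mul]
    refine intervalIntegral.integral_mono_on hT ((hEc.mul hg).intervalIntegrable _ _)
      ((by fun_prop : Continuous _).intervalIntegrable _ _) fun s hs => ?_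
    rw [← mul_assoc]
    refine mul_le_mul_of_nonneg_right ?_ (hg0 s)
    rw [hE]
    simp only
    rw [← Real.exp_add]
    apply Real.exp_le_exp.2
    have : 0 ≤ ∫ r in (0)..s, q r := intervalIntegral.integral_nonneg hs.1 fun r _ => hq0 r
    nlinarith [mul_le_mul_of_nonneg_left hs.2 hk]
  have hinv : Real.exp (-k * T + ∫ s in (0)..T, q s) * E T = 1 := by
    rw [hE]; simp only; rw [← Real.exp_add]; simp
  have h3 : V T * E T ≤ V 0 + E T * (Real.exp (∫ s in (0)..T, q s) * ∫ s in (0)..T, g s) := by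
    linarith
  have h4 := mul_le_mul_of_nonneg_left h3 (Real.exp_pos (-k * T + ∫ s in (0)..T, q s)).le
  calc V T = Real.exp (-k * T + ∫ s in (0)..T, q s) * (V T * E T) := by
        rw [mul_comm (V T), ← mul_assoc, hinv, one_mul]
    _ ≤ _ := h4
    _ = _ := by rw [mul_add, ← mul_assoc, hinv, one_mul]

/-! ### Trajectories of the Lorenz system driven by a continuous function -/

section LorenzTrajectory

variable {σ β ρ lam : ℝ}

/-- `u` solves the Lorenz system driven by `o` on `[0, T]`. -/
def IsLorenzTrajectory (σ β ρ lam : ℝ) (o : ℝ → ℝ) (T : ℝ) (u : ℝ → EuclideanSpace ℝ (Fin 3)) :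
    Prop :=
  ∀ t ∈ Icc 0 T, HasDerivWithinAt u (lorenzField σ β ρ lam (o t) (u t)) (Icc 0 T) t

lemma IsLorenzTrajectory.mono {o : ℝ → ℝ} {T T' : ℝ} {u : ℝ → EuclideanSpace ℝ (Fin 3)}
    (h : IsLorenzTrajectory σ β ρ lam o T u) (hT : T' ≤ T) :
    IsLorenzTrajectory σ β ρ lam o T' u := fun t ht =>
  (h t ⟨ht.1, ht.2.trans hT⟩).mono (Icc_subset_Icc_right hT)

lemma IsLorenzTrajectory.continuousOn {o : ℝ → ℝ} {T : ℝ} {u : ℝ → EuclideanSpace ℝ (Fin 3)}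
    (h : IsLorenzTrajectory σ β ρ lam o T u) : ContinuousOn u (Icc 0 T) := fun t ht =>
  (h t ht).continuousWithinAt

lemma IsLorenzTrajectory.hasDerivWithinAt_Ici {o : ℝ → ℝ} {T : ℝ}
    {u : ℝ → EuclideanSpace ℝ (Fin 3)} (h : IsLorenzTrajectory σ β ρ lam o T u) {t : ℝ}
    (ht : t ∈ Ico 0 T) : HasDerivWithinAt u (lorenzField σ β ρ lam (o t) (u t)) (Ici t) t :=
  (h t ⟨ht.1, ht.2.le⟩).mono_of_mem_nhdsWithin <|
    mem_of_superset (Icc_mem_nhdsGE ht.2) (Icc_subset_Icc_left ht.1)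

/-- The energy estimate for trajectories. -/
lemma IsLorenzTrajectory.energy_le {κ : ℝ} (hκ : 0 < κ) (hκσ : κ ≤ σ) (hκ1 : κ ≤ 1) (hκβ : κ ≤ β)
    {o : ℝ → ℝ} (ho : Continuous o) {T : ℝ} (hT : 0 ≤ T) {u : ℝ → EuclideanSpace ℝ (Fin 3)}
    (h : IsLorenzTrajectory σ β ρ lam o T u) :
    lorenzEnergy (σ + ρ) (u T) ≤
      Real.exp (-(κ / 2) * T + ∫ s in (0)..T, o s ^ 2 / (2 * κ)) * lorenzEnergy (σ + ρ) (u 0)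
      + Real.exp (∫ s in (0)..T, o s ^ 2 / (2 * κ))
        * ∫ s in (0)..T, energyForcing σ β ρ lam κ (o s) :=
  le_exp_mul_add_of_hasDerivWithinAt_le hT (by positivity) (by fun_prop)
    (continuous_energyForcing.comp ho) (fun t => by positivity)
    (fun t => energyForcing_nonneg hκ _) (fun t ht => hasDerivWithinAt_lorenzEnergy (h t ht))
    fun t _ => lorenzField_energy_le hκ hκσ hκ1 hκβ _ _

/-- A priori bound, also for systems slowed down by a factor `χ`. -/
lemma exists_norm_le_of_slowed_trajectory (hσ : 0 < σ) (hβ : 0 < β) (ρ lam T M : ℝ) :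
    ∃ R : ℝ, ∀ (o : ℝ → ℝ) (χ : ℝ → ℝ) (T' : ℝ) (u : ℝ → EuclideanSpace ℝ (Fin 3)),
      Continuous o → (∀ t ∈ Icc 0 T, |o t| ≤ M) → (∀ t, χ t ∈ Icc (0 : ℝ) 1) → T' ≤ T →
      (∀ t ∈ Icc 0 T', HasDerivWithinAt u (χ t • lorenzField σ β ρ lam (o t) (u t)) (Icc 0 T') t) →
      ‖u 0‖ ≤ M → ∀ t ∈ Icc 0 T', ‖u t‖ ≤ R := by
  set κ := min σ (min 1 β) with hκd
  have hκ : 0 < κ := by positivity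
  have hκσ : κ ≤ σ := min_le_left _ _
  have hκ1 : κ ≤ 1 := (min_le_right _ _).trans (min_le_left _ _)
  have hκβ : κ ≤ β := (min_le_right _ _).trans (min_le_right _ _)
  set A := T * (M ^ 2 / (2 * κ))
  set G := T * energyForcing σ β ρ lam κ M
  refine ⟨√(2 * (Real.exp A * (2 * M ^ 2 + 2 * (σ + ρ) ^ 2) + Real.exp A * G) + 2 * (σ + ρ) ^ 2), ?_⟩
  intro o χ T' u ho hoM hχ hT' hu hu0 t ht
  apply Real.le_sqrt_of_sq_le
  refine (norm_sq_le_lorenzEnergy (σ + ρ) (u t)).trans ?_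
  have ht0 : 0 ≤ t := ht.1
  have htT : t ≤ T := ht.2.trans hT'
  have hsub : Icc 0 t ⊆ Icc 0 T' := Icc_subset_Icc_right ht.2
  have hM2 : ∀ s ∈ Icc 0 t, o s ^ 2 ≤ M ^ 2 := fun s hs =>
    sq_le_sq' (abs_le.1 (hoM s ⟨hs.1, hs.2.trans htT⟩)).1 (abs_le.1 (hoM s ⟨hs.1, hs.2.trans htT⟩)).2
  -- Slowing down may destroy the dissipation, so it is discarded (`k = 0`); the remaining upper
  -- bound is nonnegative and only decreases under multiplication by `χ ≤ 1`.
  have key := le_exp_mul_add_of_hasDerivWithinAt_le (T := t) (k := 0)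
    (V := fun r => lorenzEnergy (σ + ρ) (u r)) (q := fun s => o s ^ 2 / (2 * κ))
    (g := fun s => energyForcing σ β ρ lam κ (o s)) ht0 le_rfl (by fun_prop)
    (continuous_energyForcing.comp ho) (fun t => by positivity)
    (fun t => energyForcing_nonneg hκ _)
    (fun r hr => hasDerivWithinAt_lorenzEnergy ((hu r (hsub hr)).mono hsub)) (fun r hr => by
      have h1 := lorenzField_energy_le (lam := lam) (ρ := ρ) hκ hκσ hκ1 hκβ (o r) (u r)
      have hV := lorenzEnergy_nonneg (σ + ρ) (u r)
      have hG : 0 ≤ energyForcing σ β ρ lam κ (o r) := energyForcing_nonneg hκ _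
      have hq : 0 ≤ o r ^ 2 / (2 * κ) := by positivity
      have h2 : 2 * u r 0 * lorenzField σ β ρ lam (o r) (u r) 0
          + 2 * u r 1 * lorenzField σ β ρ lam (o r) (u r) 1
          + 2 * (u r 2 - (σ + ρ)) * lorenzField σ β ρ lam (o r) (u r) 2
          ≤ o r ^ 2 / (2 * κ) * lorenzEnergy (σ + ρ) (u r) + energyForcing σ β ρ lam κ (o r) := by
        nlinarith [mul_nonneg hκ.le hV]
      have h3 := mul_le_mul_of_nonneg_left h2 (hχ r).1
      have h4 : 0 ≤ o r ^ 2 / (2 * κ) * lorenzEnergy (σ + ρ) (u r)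
        + energyForcing σ β ρ lam κ (o r) := by positivity
      have h5 := mul_le_mul_of_nonneg_right (hχ r).2 h4
      simp only [PiLp.smul_apply, smul_eq_mul]
      nlinarith)
  have hqI : ∫ s in (0)..t, o s ^ 2 / (2 * κ) ≤ A := by
    calc ∫ s in (0)..t, o s ^ 2 / (2 * κ) ≤ ∫ s in (0)..t, M ^ 2 / (2 * κ) := by
          refine intervalIntegral.integral_mono_on ht0
            ((by fun_prop : Continuous _).intervalIntegrable _ _) (by simp) fun s hs => ?_
          gcongr ?_ / _
          exact hM2 s hs
      _ = t * (M ^ 2 / (2 * κ)) := by simp [mul_div_assoc]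
      _ ≤ A := mul_le_mul_of_nonneg_right htT (by positivity)
  have hgI : ∫ s in (0)..t, energyForcing σ β ρ lam κ (o s) ≤ G := by
    calc ∫ s in (0)..t, energyForcing σ β ρ lam κ (o s)
        ≤ ∫ s in (0)..t, energyForcing σ β ρ lam κ M := by
          refine intervalIntegral.integral_mono_on ht0
            ((continuous_energyForcing.comp ho).intervalIntegrable _ _) (by simp) fun s hs => ?_
          unfold energyForcing
          refine div_le_div_of_nonneg_right ?_ hκ.le
          have := mul_le_mul_of_nonneg_left (hM2 s hs) (sq_nonneg (β - lam))
          linarith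
      _ = t * energyForcing σ β ρ lam κ M := by simp
      _ ≤ G := mul_le_mul_of_nonneg_right htT (energyForcing_nonneg hκ _)
  have hg0 : 0 ≤ ∫ s in (0)..t, energyForcing σ β ρ lam κ (o s) :=
    intervalIntegral.integral_nonneg ht0 fun _ _ => energyForcing_nonneg hκ _
  have hV0 : lorenzEnergy (σ + ρ) (u 0) ≤ 2 * M ^ 2 + 2 * (σ + ρ) ^ 2 := by
    refine (lorenzEnergy_le _ _).trans ?_
    have := pow_le_pow_left₀ (norm_nonneg _) hu0 2
    linarith
  have hA := Real.exp_le_exp.2 hqI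
  rw [neg_zero, zero_mul, zero_add] at key
  have h1 : Real.exp (∫ s in (0)..t, o s ^ 2 / (2 * κ)) * lorenzEnergy (σ + ρ) (u 0) ≤
      Real.exp A * (2 * M ^ 2 + 2 * (σ + ρ) ^ 2) :=
    mul_le_mul hA hV0 (lorenzEnergy_nonneg _ _) (Real.exp_pos _).le
  have h2 := mul_le_mul hA hgI hg0 (Real.exp_pos _).le
  linarith

lemma exists_norm_le_of_trajectory (hσ : 0 < σ) (hβ : 0 < β) (ρ lam T M : ℝ) :
    ∃ R : ℝ, ∀ (o : ℝ → ℝ) (u : ℝ → EuclideanSpace ℝ (Fin 3)),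
      Continuous o → (∀ t ∈ Icc 0 T, |o t| ≤ M) → IsLorenzTrajectory σ β ρ lam o T u →
      ‖u 0‖ ≤ M → ∀ t ∈ Icc 0 T, ‖u t‖ ≤ R := by
  obtain ⟨R, hR⟩ := exists_norm_le_of_slowed_trajectory hσ hβ ρ lam T M
  exact ⟨R, fun o u ho hoM hu hu0 => hR o (fun _ => 1) T u ho hoM (by simp) le_rfl
    (by simpa [IsLorenzTrajectory] using hu) hu0⟩

/-- Trajectories depend in a Lipschitz way on the initial point and the driving function. -/
lemma exists_dist_trajectory_le (hσ : 0 < σ) (hβ : 0 < β) (ρ lam T M : ℝ) :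
    ∃ C : ℝ, 0 ≤ C ∧ ∀ (o o' : ℝ → ℝ) (u u' : ℝ → EuclideanSpace ℝ (Fin 3)) (ε : ℝ),
      Continuous o → Continuous o' → (∀ t ∈ Icc 0 T, |o t| ≤ M) → (∀ t ∈ Icc 0 T, |o' t| ≤ M) →
      IsLorenzTrajectory σ β ρ lam o T u → IsLorenzTrajectory σ β ρ lam o' T u' →
      ‖u 0‖ ≤ M → ‖u' 0‖ ≤ M → (∀ t ∈ Icc 0 T, |o t - o' t| ≤ ε) → 0 ≤ ε →
      ∀ t ∈ Icc 0 T, dist (u t) (u' t) ≤ C * (dist (u 0) (u' 0) + ε) := by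
  obtain ⟨R, hR⟩ := exists_norm_le_of_trajectory hσ hβ ρ lam T M
  obtain ⟨K, hK1, hK⟩ := exists_norm_lorenzField_sub_le σ β ρ lam (max M R)
  lift K to ℝ≥0 using by linarith
  have hK0 : (0 : ℝ) < K := by linarith
  refine ⟨Real.exp (K * |T|) + Real.exp (K * |T|), by positivity, ?_⟩
  intro o o' u u' ε ho ho' hoM ho'M hu hu' hu0 hu'0 hε hε0 t ht
  have hb := hR o u ho hoM hu hu0
  have hb' := hR o' u' ho' ho'M hu' hu'0
  have hle := dist_le_of_approx_trajectories_ODE_of_mem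
    (v := fun t => lorenzField σ β ρ lam (o t)) (K := K)
    (s := fun _ => Metric.closedBall 0 R) (f := u) (g := u') (a := 0) (b := T)
    (f' := fun t => lorenzField σ β ρ lam (o t) (u t))
    (g' := fun t => lorenzField σ β ρ lam (o' t) (u' t)) (δ := dist (u 0) (u' 0)) (εf := 0)
    (εg := K * ε) (fun t ht => LipschitzOnWith.of_dist_le_mul fun x hx y hy => by
      rw [dist_eq_norm, dist_eq_norm]
      have := hK (o t) (o t) x y ((hoM t (Ico_subset_Icc_self ht)).trans (le_max_left _ _))
        ((mem_closedBall_zero_iff.1 hx).trans (le_max_right _ _))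
        ((mem_closedBall_zero_iff.1 hy).trans (le_max_right _ _))
      simpa using this)
    hu.continuousOn (fun t ht => hu.hasDerivWithinAt_Ici ht) (fun t _ => by simp)
    (fun t ht => mem_closedBall_zero_iff.2 (hb t (Ico_subset_Icc_self ht)))
    hu'.continuousOn (fun t ht => hu'.hasDerivWithinAt_Ici ht) (fun t ht => by
      rw [dist_comm, dist_eq_norm]
      have ht' := Ico_subset_Icc_self ht
      have := hK (o t) (o' t) (u' t) (u' t) ((hoM t ht').trans (le_max_left _ _))
        ((hb' t ht').trans (le_max_right _ _)) ((hb' t ht').trans (le_max_right _ _))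
      rw [sub_self, norm_zero, add_zero] at this
      exact this.trans (mul_le_mul_of_nonneg_left (hε t ht') hK0.le))
    (fun t ht => mem_closedBall_zero_iff.2 (hb' t (Ico_subset_Icc_self ht))) le_rfl t ht
  refine hle.trans ?_
  rw [gronwallBound_of_K_ne_0 (by exact_mod_cast hK0.ne')]
  simp only [zero_add, sub_zero]
  rw [mul_div_cancel_left₀ _ hK0.ne']
  have h1 : Real.exp (K * t) ≤ Real.exp (K * |T|) :=
    Real.exp_le_exp.2 (mul_le_mul_of_nonneg_left (ht.2.trans (le_abs_self T)) hK0.le)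
  have h2 := dist_nonneg (x := u 0) (y := u' 0)
  have h3 := Real.exp_pos (K * |T|)
  have h4 := mul_le_mul_of_nonneg_left h1 h2
  have h5 := mul_le_mul_of_nonneg_left h1 hε0
  have h6 : 0 ≤ Real.exp (K * |T|) * ε := by positivity
  have h7 : 0 ≤ Real.exp (K * |T|) * dist (u 0) (u' 0) := by positivity
  nlinarith

lemma exists_abs_le_of_continuous {o : ℝ → ℝ} (ho : Continuous o) (T : ℝ) :
    ∃ M, ∀ t ∈ Icc 0 T, |o t| ≤ M := by
  obtain ⟨M, hM⟩ := (isCompact_Icc (a := (0 : ℝ)) (b := T)).exists_bound_of_continuousOn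
    ho.continuousOn
  exact ⟨M, by simpa using hM⟩

lemma IsLorenzTrajectory.eqOn (hσ : 0 < σ) (hβ : 0 < β) {o : ℝ → ℝ} (ho : Continuous o) {T : ℝ}
    {u u' : ℝ → EuclideanSpace ℝ (Fin 3)} (hu : IsLorenzTrajectory σ β ρ lam o T u)
    (hu' : IsLorenzTrajectory σ β ρ lam o T u') (h0 : u 0 = u' 0) : EqOn u u' (Icc 0 T) := by
  obtain ⟨M, hM⟩ := exists_abs_le_of_continuous ho T
  obtain ⟨C, hC, h⟩ := exists_dist_trajectory_le hσ hβ ρ lam T (max M ‖u 0‖)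
  intro t ht
  have hM' : ∀ t ∈ Icc 0 T, |o t| ≤ max M ‖u 0‖ := fun t ht => (hM t ht).trans (le_max_left _ _)
  have := h o o u u' 0 ho ho hM' hM' hu hu' (le_max_right _ _) (h0 ▸ le_max_right _ _) (by simp)
    le_rfl t ht
  rw [h0, dist_self, add_zero, mul_zero] at this
  exact dist_le_zero.1 this

lemma exists_isLorenzTrajectory (hσ : 0 < σ) (hβ : 0 < β) {o : ℝ → ℝ} (ho : Continuous o) {T : ℝ}
    (hT : 0 ≤ T) (v : EuclideanSpace ℝ (Fin 3)) :
    ∃ u, u 0 = v ∧ IsLorenzTrajectory σ β ρ lam o T u := by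
  obtain ⟨M₀, hM₀⟩ := exists_abs_le_of_continuous ho T
  set M := max M₀ ‖v‖
  have hM : ∀ t ∈ Icc 0 T, |o t| ≤ M := fun t ht => (hM₀ t ht).trans (le_max_left _ _)
  have hv : ‖v‖ ≤ M := le_max_right _ _
  obtain ⟨R, hR⟩ := exists_norm_le_of_slowed_trajectory hσ hβ ρ lam T M
  -- A cutoff equal to `1` on the ball of radius `R` and to `0` outside radius `R + 1`. The
  -- truncated field is bounded, and the a priori bound `R`, valid for slowed systems, keeps its
  -- solution where `χ = 1`.
  set χ : EuclideanSpace ℝ (Fin 3) → ℝ := fun x => max 0 (min 1 (R + 1 - ‖x‖)) with hχ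
  have hχ01 : ∀ x, χ x ∈ Icc (0 : ℝ) 1 := fun x =>
    ⟨le_max_left _ _, max_le zero_le_one (min_le_left _ _)⟩
  have hχL : ∀ x y, |χ x - χ y| ≤ ‖x - y‖ := fun x y => by
    refine (abs_max_sub_max_le_max _ _ _ _).trans ?_
    refine max_le (by simp) ((abs_min_sub_min_le_max _ _ _ _).trans (max_le (by simp) ?_))
    rw [sub_sub_sub_cancel_left, abs_sub_comm]
    exact abs_norm_sub_norm_le x y
  have hbound : ∀ M' : ℝ, M ≤ M' → ∃ L : ℝ≥0, ∀ t ∈ Icc 0 T, ∀ x, ‖x‖ ≤ M' →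
      ‖lorenzField σ β ρ lam (o t) x‖ ≤ L := fun M' hM' => by
    obtain ⟨K, hK1, hK⟩ := exists_norm_lorenzField_sub_le σ β ρ lam M'
    have hM'0 : 0 ≤ M' := (norm_nonneg v).trans (hv.trans hM')
    refine ⟨⟨K * (M' + M'), by positivity⟩, fun t ht x hx => ?_⟩
    have hz : lorenzField σ β ρ lam 0 0 = 0 := by
      ext i; fin_cases i <;> simp [lorenzField]
    have := hK (o t) 0 x 0 ((hM t ht).trans hM') hx (by simpa using hM'0)
    rw [hz] at this
    simp only [sub_zero] at this
    refine this.trans ?_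
    show _ ≤ K * (M' + M')
    gcongr
    exact (hM t ht).trans hM'
  obtain ⟨L, hL⟩ := hbound (max M (R + 1)) (le_max_left _ _)
  set T' : ℝ≥0 := ⟨T, hT⟩
  -- At speed at most `L` a curve travels at most `L T` in time `T`, so a single Picard–Lindelöf
  -- ball serves the whole interval. The constants `L₂` and `K` below enter only its Lipschitz
  -- constant.
  set a : ℝ≥0 := L * T' with ha
  obtain ⟨L₂, hL₂⟩ := hbound (max M (‖v‖ + a)) (le_max_left _ _)
  obtain ⟨K, hK1, hK⟩ := exists_norm_lorenzField_sub_le σ β ρ lam (max M (‖v‖ + a))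
  lift K to ℝ≥0 using by linarith
  have hball : ∀ x ∈ Metric.closedBall v (a : ℝ), ‖x‖ ≤ max M (‖v‖ + a) := fun x hx => by
    refine le_trans ?_ (le_max_right _ _)
    have := norm_le_norm_add_norm_sub' x v
    rw [Metric.mem_closedBall, dist_eq_norm] at hx
    linarith
  have hPL : IsPicardLindelof (fun t x => χ x • lorenzField σ β ρ lam (o t) x)
      (tmin := 0) (tmax := T) ⟨0, left_mem_Icc.2 hT⟩ v a 0 L
      (L₂ + K) := by
    refine ⟨fun t ht => LipschitzOnWith.of_dist_le_mul fun x hx y hy => ?_, fun x _ => ?_,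
      fun t ht x _ => ?_, ?_⟩
    · rw [dist_eq_norm, dist_eq_norm]
      have e : χ x • lorenzField σ β ρ lam (o t) x - χ y • lorenzField σ β ρ lam (o t) y =
          (χ x - χ y) • lorenzField σ β ρ lam (o t) x
          + χ y • (lorenzField σ β ρ lam (o t) x - lorenzField σ β ρ lam (o t) y) := by
        module
      rw [e]
      refine (norm_add_le _ _).trans ?_
      rw [norm_smul, norm_smul, Real.norm_eq_abs, Real.norm_eq_abs, abs_of_nonneg (hχ01 y).1]
      have h1 := hK (o t) (o t) x y ((hM t ht).trans (le_max_left _ _)) (hball x hx) (hball y hy)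
      rw [sub_self, abs_zero, zero_add] at h1
      have h2 := mul_le_mul (hχL x y) (hL₂ t ht x (hball x hx)) (norm_nonneg _) (norm_nonneg _)
      have h3 := mul_le_mul (hχ01 y).2 h1 (norm_nonneg _) zero_le_one
      rw [NNReal.coe_add]
      linarith
    · have : Continuous fun t => lorenzField σ β ρ lam (o t) x :=
        continuous_lorenzField.comp (ho.prodMk continuous_const)
      exact (this.const_smul (χ x)).continuousOn
    · rw [norm_smul, Real.norm_eq_abs, abs_of_nonneg (hχ01 x).1]
      by_cases hx : ‖x‖ ≤ R + 1
      · exact (mul_le_mul (hχ01 x).2 (hL t ht x (hx.trans (le_max_right _ _))) (norm_nonneg _)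
          zero_le_one).trans (one_mul _).le
      · have : χ x = 0 := by
          rw [hχ]
          exact max_eq_left ((min_le_right _ _).trans (by linarith))
        rw [this, zero_mul]
        exact L.2
    · simp only [sub_zero, sub_self, max_eq_left hT, NNReal.coe_zero, ha, NNReal.coe_mul]
      exact le_rfl
  obtain ⟨u, hu0, hu⟩ := hPL.exists_eq_forall_mem_Icc_hasDerivWithinAt₀
  have hu0' : u 0 = v := hu0
  have hbd := hR o (fun t => χ (u t)) T u ho hM (fun t => hχ01 _) le_rfl hu (hu0' ▸ hv)
  refine ⟨u, hu0', fun t ht => ?_⟩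
  have h1 : χ (u t) = 1 := by
    have := hbd t ht
    rw [hχ]
    simp only
    rw [min_eq_left (by linarith), max_eq_right zero_le_one]
  simpa [h1] using hu t ht

/-- A solution of the driven Lorenz system on `[0, ∞)`. -/
lemma exists_global_lorenz_solution (hσ : 0 < σ) (hβ : 0 < β) (ρ lam : ℝ) (o : C(ℝ, ℝ))
    (v : EuclideanSpace ℝ (Fin 3)) :
    ∃ u : ℝ → EuclideanSpace ℝ (Fin 3), u 0 = v ∧ ∀ t ∈ Ici (0 : ℝ),
      HasDerivWithinAt u (lorenzField σ β ρ lam (o t) (u t)) (Ici 0) t := by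
  have h : ∀ n : ℕ, ∃ u, u 0 = v ∧ IsLorenzTrajectory σ β ρ lam o n u := fun n =>
    exists_isLorenzTrajectory hσ hβ o.continuous n.cast_nonneg v
  choose u hu0 hu using h
  have hcompat : ∀ m n : ℕ, m ≤ n → EqOn (u m) (u n) (Icc 0 (m : ℝ)) := fun m n hmn =>
    (hu m).eqOn hσ hβ o.continuous ((hu n).mono (by exact_mod_cast hmn)) (by rw [hu0, hu0])
  -- The solutions on `[0, n]` are glued by evaluating the one with index `⌈t⌉₊` at time `t`;
  -- uniqueness makes this independent of the index.
  have hU : ∀ n : ℕ, EqOn (fun t => u ⌈t⌉₊ t) (u n) (Icc 0 (n : ℝ)) := fun n t ht =>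
    hcompat _ _ (Nat.ceil_le.2 ht.2) ⟨ht.1, Nat.le_ceil t⟩
  refine ⟨fun t => u ⌈t⌉₊ t, by simp [hu0], fun t ht => ?_⟩
  obtain ⟨n, hn⟩ := exists_nat_gt t
  have hmem : t ∈ Icc (0 : ℝ) n := ⟨ht, hn.le⟩
  have h1 : HasDerivWithinAt (fun t => u ⌈t⌉₊ t)
      (lorenzField σ β ρ lam (o t) (u ⌈t⌉₊ t)) (Icc 0 (n : ℝ)) t := by
    have := (hu n t hmem).congr_of_mem (hU n) hmem
    rwa [← hU n hmem] at this
  refine h1.mono_of_mem_nhdsWithin ?_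
  rw [← Ici_inter_Iic]
  exact inter_mem self_mem_nhdsWithin (mem_nhdsWithin_of_mem_nhds (Iic_mem_nhds hn))

end LorenzTrajectory

/-! ### The deterministic solution map on `[0, ∞)` and its joint continuity. -/

section LorenzFlow

variable {σ β ρ lam : ℝ}

/-- The solution of the Lorenz system driven by `o` and started at `v`. -/
noncomputable def lorenzFlow (σ β ρ lam : ℝ) (o : C(ℝ, ℝ)) (v : EuclideanSpace ℝ (Fin 3)) :
    ℝ → EuclideanSpace ℝ (Fin 3) :=
  Classical.epsilon fun u => u 0 = v ∧ ∀ t ∈ Ici (0 : ℝ),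
    HasDerivWithinAt u (lorenzField σ β ρ lam (o t) (u t)) (Ici 0) t

lemma lorenzFlow_zero (hσ : 0 < σ) (hβ : 0 < β) (o : C(ℝ, ℝ)) (v : EuclideanSpace ℝ (Fin 3)) :
    lorenzFlow σ β ρ lam o v 0 = v :=
  (Classical.epsilon_spec (exists_global_lorenz_solution hσ hβ ρ lam o v)).1

lemma hasDerivWithinAt_lorenzFlow (hσ : 0 < σ) (hβ : 0 < β) (o : C(ℝ, ℝ))
    (v : EuclideanSpace ℝ (Fin 3)) {t : ℝ} (ht : 0 ≤ t) :
    HasDerivWithinAt (lorenzFlow σ β ρ lam o v)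
      (lorenzField σ β ρ lam (o t) (lorenzFlow σ β ρ lam o v t)) (Ici 0) t :=
  (Classical.epsilon_spec (exists_global_lorenz_solution hσ hβ ρ lam o v)).2 t ht

lemma isLorenzTrajectory_of_hasDerivWithinAt {o : ℝ → ℝ} {u : ℝ → EuclideanSpace ℝ (Fin 3)}
    (hu : ∀ t, 0 ≤ t → HasDerivWithinAt u (lorenzField σ β ρ lam (o t) (u t)) (Ici 0) t) (T : ℝ) :
    IsLorenzTrajectory σ β ρ lam o T u := fun t ht => (hu t ht.1).mono Icc_subset_Ici_self

lemma isLorenzTrajectory_lorenzFlow (hσ : 0 < σ) (hβ : 0 < β) (o : C(ℝ, ℝ))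
    (v : EuclideanSpace ℝ (Fin 3)) (T : ℝ) :
    IsLorenzTrajectory σ β ρ lam o T (lorenzFlow σ β ρ lam o v) :=
  isLorenzTrajectory_of_hasDerivWithinAt
    (fun _ ht => hasDerivWithinAt_lorenzFlow hσ hβ o v ht) T

lemma eq_lorenzFlow (hσ : 0 < σ) (hβ : 0 < β) (o : C(ℝ, ℝ)) {u : ℝ → EuclideanSpace ℝ (Fin 3)}
    (hu : ∀ t, 0 ≤ t → HasDerivWithinAt u (lorenzField σ β ρ lam (o t) (u t)) (Ici 0) t)
    {t : ℝ} (ht : 0 ≤ t) : u t = lorenzFlow σ β ρ lam o (u 0) t :=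
  (isLorenzTrajectory_of_hasDerivWithinAt hu t).eqOn hσ hβ o.continuous
    (isLorenzTrajectory_lorenzFlow hσ hβ o _ t) (lorenzFlow_zero hσ hβ o _).symm ⟨ht, le_rfl⟩

/-- The time-translated trajectory solves the system with translated driver, so uniqueness
identifies it. This is the source of the cocycle property. -/
lemma lorenzFlow_add (hσ : 0 < σ) (hβ : 0 < β) {o o' : C(ℝ, ℝ)} {s : ℝ} (hs : 0 ≤ s)
    (ho : ∀ r, o' r = o (r + s)) (v : EuclideanSpace ℝ (Fin 3)) {t : ℝ} (ht : 0 ≤ t) :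
    lorenzFlow σ β ρ lam o v (t + s) =
      lorenzFlow σ β ρ lam o' (lorenzFlow σ β ρ lam o v s) t := by
  have := eq_lorenzFlow (ρ := ρ) (lam := lam) hσ hβ o'
    (u := fun r => lorenzFlow σ β ρ lam o v (r + s)) (fun r hr => by
      rw [ho r]
      have h := hasDerivWithinAt_lorenzFlow (ρ := ρ) (lam := lam) hσ hβ o v (add_nonneg hr hs)
      have h2 := HasDerivWithinAt.scomp (t' := Ici (0 : ℝ)) (s := Ici (0 : ℝ))
        (h := fun r => r + s) r h ((hasDerivWithinAt_id r _).add_const s)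
        (fun x hx => add_nonneg hx hs)
      simpa [Function.comp_def] using h2) ht
  simpa using this

lemma continuousOn_lorenzFlow (hσ : 0 < σ) (hβ : 0 < β) (o : C(ℝ, ℝ))
    (v : EuclideanSpace ℝ (Fin 3)) : ContinuousOn (lorenzFlow σ β ρ lam o v) (Ici 0) :=
  fun _ ht => (hasDerivWithinAt_lorenzFlow hσ hβ o v ht).continuousWithinAt

/-- The solution is jointly continuous in the driving function, the time, and the initial point. -/
lemma continuous_lorenzFlow (hσ : 0 < σ) (hβ : 0 < β) :
    Continuous fun p : C(ℝ, ℝ) × ℝ≥0 × EuclideanSpace ℝ (Fin 3) =>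
      lorenzFlow σ β ρ lam p.1 p.2.2 p.2.1 := by
  rw [continuous_iff_continuousAt]
  rintro ⟨o, t, v⟩
  -- The horizon `t + 1` and the margins `M + 1`, `‖v‖ + 1` leave room for all nearby times, drivers
  -- and initial points, so one Lipschitz constant serves a whole neighbourhood.
  obtain ⟨M, hM⟩ := exists_abs_le_of_continuous o.continuous (t + 1)
  obtain ⟨C, hC, hlip⟩ := exists_dist_trajectory_le hσ hβ ρ lam (t + 1) (max (M + 1) (‖v‖ + 1))
  rw [ContinuousAt, Metric.tendsto_nhds]
  intro ε hε
  obtain ⟨δ, hδ0, hδ1, hδ⟩ : ∃ δ, 0 < δ ∧ δ ≤ 1 ∧ C * (δ + δ) < ε / 2 := by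
    refine ⟨min 1 (ε / (4 * (C + 1)) / 2), by positivity, min_le_left _ _, ?_⟩
    have h1 : min 1 (ε / (4 * (C + 1)) / 2) ≤ ε / (4 * (C + 1)) / 2 := min_le_right _ _
    have h2 : C * (ε / (4 * (C + 1))) ≤ ε / 4 := by
      rw [← mul_div_assoc, div_le_div_iff₀ (by positivity) (by positivity)]
      nlinarith
    nlinarith
  have e1 : ∀ᶠ p : C(ℝ, ℝ) × ℝ≥0 × EuclideanSpace ℝ (Fin 3) in 𝓝 (o, t, v),
      ∀ r ∈ Icc (0 : ℝ) (t + 1), dist (o r) (p.1 r) < δ := by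
    have h := ContinuousMap.tendsto_iff_forall_isCompact_tendstoUniformlyOn.1
      (tendsto_id (x := 𝓝 o)) (Icc (0 : ℝ) (t + 1)) isCompact_Icc
    exact (continuous_fst.tendsto (o, t, v)).eventually (Metric.tendstoUniformlyOn_iff.1 h δ hδ0)
  have e2 : ∀ᶠ p : C(ℝ, ℝ) × ℝ≥0 × EuclideanSpace ℝ (Fin 3) in 𝓝 (o, t, v),
      dist p.2.2 v < δ :=
    (continuous_snd.snd.tendsto (o, t, v)).eventually (Metric.ball_mem_nhds v hδ0)
  have ht : Tendsto (fun p : C(ℝ, ℝ) × ℝ≥0 × EuclideanSpace ℝ (Fin 3) => (p.2.1 : ℝ))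
      (𝓝 (o, t, v)) (𝓝 (t : ℝ)) :=
    (by fun_prop : Continuous fun p : C(ℝ, ℝ) × ℝ≥0 × EuclideanSpace ℝ (Fin 3) =>
      (p.2.1 : ℝ)).tendsto _
  have e3 : ∀ᶠ p : C(ℝ, ℝ) × ℝ≥0 × EuclideanSpace ℝ (Fin 3) in 𝓝 (o, t, v), (p.2.1 : ℝ) < t + 1 :=
    ht.eventually (Iio_mem_nhds (by linarith))
  have e4 : ∀ᶠ p : C(ℝ, ℝ) × ℝ≥0 × EuclideanSpace ℝ (Fin 3) in 𝓝 (o, t, v),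
      dist (lorenzFlow σ β ρ lam o v p.2.1) (lorenzFlow σ β ρ lam o v t) < ε / 2 := by
    have hc := (continuousOn_lorenzFlow (ρ := ρ) (lam := lam) hσ hβ o v) t t.2
    have := hc.tendsto.comp (tendsto_nhdsWithin_iff.2 ⟨ht, Eventually.of_forall fun p => p.2.1.2⟩)
    exact (Metric.tendsto_nhds.1 this) _ (half_pos hε)
  filter_upwards [e1, e2, e3, e4] with p h1 h2 h3 h4
  have h5 := hlip p.1 o (lorenzFlow σ β ρ lam p.1 p.2.2) (lorenzFlow σ β ρ lam o v) δ
    p.1.continuous o.continuous (fun r hr => by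
      refine le_trans ?_ (le_max_left _ _)
      have h6 := h1 r hr
      rw [Real.dist_eq, abs_sub_comm] at h6
      have h7 := abs_sub_abs_le_abs_sub (p.1 r) (o r)
      have := hM r hr
      linarith)
    (fun r hr => (hM r hr).trans ((by linarith : M ≤ M + 1).trans (le_max_left _ _)))
    (isLorenzTrajectory_lorenzFlow hσ hβ _ _ _) (isLorenzTrajectory_lorenzFlow hσ hβ _ _ _)
    (by
      rw [lorenzFlow_zero hσ hβ]
      refine le_trans ?_ (le_max_right _ _)
      rw [dist_eq_norm] at h2
      have := norm_le_norm_add_norm_sub' p.2.2 v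
      linarith)
    (by
      rw [lorenzFlow_zero hσ hβ]
      exact (by linarith : ‖v‖ ≤ ‖v‖ + 1).trans (le_max_right _ _))
    (fun r hr => by
      have := (h1 r hr).le
      rwa [Real.dist_eq, abs_sub_comm] at this) hδ0.le p.2.1 ⟨p.2.1.2, h3.le⟩
  rw [lorenzFlow_zero hσ hβ, lorenzFlow_zero hσ hβ] at h5
  have h6 : C * (dist p.2.2 v + δ) ≤ C * (δ + δ) :=
    mul_le_mul_of_nonneg_left (by linarith) hC
  calc dist (lorenzFlow σ β ρ lam p.1 p.2.2 p.2.1) (lorenzFlow σ β ρ lam o v t) ≤ _ :=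
        dist_triangle _ (lorenzFlow σ β ρ lam o v p.2.1) _
    _ < ε := by linarith

end LorenzFlow

/-! ### Measurability on spaces of continuous functions -/

/-- A map into `C(ℝ, ℝ)` is Borel measurable as soon as all its evaluations are measurable. -/
lemma ContinuousMap.measurable_of_eval {α : Type*} [MeasurableSpace α] {f : α → C(ℝ, ℝ)}
    (hf : ∀ t, Measurable fun a => f a t) : Measurable[_, borel C(ℝ, ℝ)] f := by
  rw [borel_eq_generateFrom_of_subbasis ContinuousMap.compactOpen_eq]
  refine measurable_generateFrom ?_
  rintro _ ⟨K, hK, U, hU, rfl⟩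
  replace hU : IsOpen U := hU
  replace hK : IsCompact K := hK
  -- The full set is treated apart because the distance to an empty complement is `0` by convention.
  rcases eq_or_ne U univ with rfl | hUne
  · simp
  have hUc : (Uᶜ).Nonempty := nonempty_compl.2 hUne
  obtain ⟨D, hDK, hDc, hD⟩ :=
    (TopologicalSpace.IsSeparable.of_separableSpace K).exists_countable_dense_subset
  -- On a compact `K`, mapping into an open `U` means staying at a positive distance from `Uᶜ`, and
  -- by continuity this can be tested on a countable dense subset of `K`.
  have key : f ⁻¹' {g : C(ℝ, ℝ) | MapsTo g K U} =
      ⋃ n : ℕ, ⋂ q ∈ D, {a | 1 / ((n : ℝ) + 1) ≤ Metric.infDist (f a q) Uᶜ} := by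
    ext a
    simp only [mem_preimage, mem_ofPred_eq, mem_iUnion, mem_iInter]
    have hc : Continuous fun x => Metric.infDist (f a x) Uᶜ :=
      (Metric.continuous_infDist_pt _).comp (f a).continuous
    constructor
    · intro h
      rcases K.eq_empty_or_nonempty with rfl | hKne
      · exact ⟨0, fun q hq => absurd (hDK hq) (notMem_empty q)⟩
      obtain ⟨x, hx, hmin⟩ := hK.exists_isMinOn hKne hc.continuousOn
      have hpos : 0 < Metric.infDist (f a x) Uᶜ :=
        (hU.isClosed_compl.notMem_iff_infDist_pos hUc).1 fun h' => h' (h hx)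
      obtain ⟨n, hn⟩ := exists_nat_one_div_lt hpos
      exact ⟨n, fun q hq => hn.le.trans (hmin (hDK hq))⟩
    · rintro ⟨n, hn⟩ x hx
      have hcl : IsClosed {x | 1 / ((n : ℝ) + 1) ≤ Metric.infDist (f a x) Uᶜ} :=
        isClosed_le continuous_const hc
      have h1 : 1 / ((n : ℝ) + 1) ≤ Metric.infDist (f a x) Uᶜ :=
        closure_minimal (fun q hq => hn q hq) hcl (hD hx)
      have h2 : 0 < Metric.infDist (f a x) Uᶜ := lt_of_lt_of_le (by positivity) h1
      exact notMem_compl_iff.1 ((hU.isClosed_compl.notMem_iff_infDist_pos hUc).2 h2)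
  rw [key]
  exact MeasurableSet.iUnion fun n => MeasurableSet.biInter hDc fun q _ =>
    measurableSet_le measurable_const ((Metric.continuous_infDist_pt _).measurable.comp (hf q))

namespace PathSpace

lemma measurable_eval (t : ℝ) : Measurable fun ω : PathSpace => ω t :=
  (measurable_pi_apply t).comp (comap_measurable _)

lemma continuous_apply (ω : PathSpace) : Continuous fun t => ω t := ω.1.continuous

lemma apply_zero (ω : PathSpace) : ω 0 = 0 := ω.2

lemma ext {ω ω' : PathSpace} (h : ∀ t, ω t = ω' t) : ω = ω' :=
  Subtype.ext (ContinuousMap.ext h)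

lemma measurable_of_eval {α : Type*} [MeasurableSpace α] {f : α → PathSpace}
    (hf : ∀ t, Measurable fun a => f a t) : Measurable f :=
  measurable_comap_iff.2 (measurable_pi_lambda _ hf)

lemma measurable_apply : Measurable fun p : ℝ × PathSpace => p.2 p.1 :=
  measurable_uncurry_of_continuous_of_measurable (u := fun (t : ℝ) (ω : PathSpace) => ω t)
    (fun ω => ω.continuous_apply) measurable_eval

lemma shift_apply (t s : ℝ) (ω : PathSpace) : shift t ω s = ω (s + t) - ω t := rfl

lemma shift_zero (ω : PathSpace) : shift 0 ω = ω :=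
  ext fun s => by simp [shift_apply, apply_zero]

lemma shift_add (s t : ℝ) (ω : PathSpace) : shift (t + s) ω = shift t (shift s ω) :=
  ext fun r => by simp [shift_apply, add_assoc]

lemma measurable_shift : Measurable fun p : ℝ × PathSpace => shift p.1 p.2 := by
  refine measurable_of_eval fun t => ?_
  have h1 : Measurable fun p : ℝ × PathSpace => (t + p.1, p.2) := by fun_prop
  exact (measurable_apply.comp h1).sub measurable_apply

lemma measurable_shift_apply (t : ℝ) : Measurable (shift t) :=
  measurable_shift.comp measurable_prodMk_left

end PathSpace

/-! ### The Ornstein–Uhlenbeck process -/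

section OU

open PathSpace

variable {γ lam : ℝ}

lemma measurable_ouVar : Measurable (ouVar γ lam) := by
  unfold ouVar
  refine Measurable.neg (StronglyMeasurable.measurable ?_)
  refine StronglyMeasurable.integral_prod_left (f := fun (s : ℝ) (ω : PathSpace) => γ * lam * Real.exp (lam * s) * ω s) ?_
  refine Measurable.stronglyMeasurable ?_
  have := measurable_apply
  simp only [Function.uncurry_def]
  fun_prop

/-- The paths for which the integral defining the Ornstein–Uhlenbeck variable converges. -/
def OUIntegrable (lam : ℝ) (ω : PathSpace) : Prop :=
  IntegrableOn (fun s => Real.exp (lam * s) * ω s) (Iic 0)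

lemma OUIntegrable.integrableOn_Iic {ω : PathSpace} (h : OUIntegrable lam ω) (t : ℝ) :
    IntegrableOn (fun s => Real.exp (lam * s) * ω s) (Iic t) := by
  have hc : Continuous fun s => Real.exp (lam * s) * ω s := by
    have := ω.continuous_apply
    fun_prop
  refine (IntegrableOn.union h (hc.integrableOn_Icc (a := 0) (b := t))).mono_set fun s hs => ?_
  rcases le_total s 0 with h | h
  · exact Or.inl h
  · exact Or.inr ⟨h, hs⟩

lemma preimage_add_right_Iic (t : ℝ) : (fun s : ℝ => s + t) ⁻¹' Iic t = Iic 0 := by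
  ext s; simp

lemma OUIntegrable.integrableOn_add {ω : PathSpace} (h : OUIntegrable lam ω) (t : ℝ) :
    IntegrableOn (fun s => Real.exp (lam * s) * ω (s + t)) (Iic 0) := by
  have h1 := h.integrableOn_Iic t
  rw [← (measurePreserving_add_right volume t).integrableOn_comp_preimage
    (measurableEmbedding_addRight t), preimage_add_right_Iic] at h1
  have h2 := h1.const_mul (Real.exp (-(lam * t)))
  refine IntegrableOn.congr_fun h2 (fun s _ => ?_) measurableSet_Iic
  simp only [Function.comp]
  rw [← mul_assoc, ← Real.exp_add]
  ring_nf

lemma OUIntegrable.shift (hlam : 0 < lam) {ω : PathSpace} (h : OUIntegrable lam ω) (t : ℝ) :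
    OUIntegrable lam (shift t ω) := by
  have h2 := (h.integrableOn_add t).sub ((integrableOn_exp_mul_Iic hlam 0).mul_const (ω t))
  refine IntegrableOn.congr_fun h2 (fun s _ => ?_) measurableSet_Iic
  simp [shift_apply, mul_sub]

lemma ouIntegrable_shift_iff (hlam : 0 < lam) {ω : PathSpace} (t : ℝ) :
    OUIntegrable lam (PathSpace.shift t ω) ↔ OUIntegrable lam ω := by
  refine ⟨fun h => ?_, fun h => h.shift hlam t⟩
  have := h.shift hlam (-t)
  rwa [← shift_add, neg_add_cancel, shift_zero] at this

/-- The Bochner integral of a nonintegrable function is `0` by definition; for `γ = 0` the integrand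
vanishes anyway. -/
lemma ouVar_of_not_ouIntegrable (hlam : 0 < lam) {ω : PathSpace} (h : ¬ OUIntegrable lam ω) :
    ouVar γ lam ω = 0 := by
  by_cases hγ : γ = 0
  · simp [ouVar, hγ]
  · rw [ouVar, integral_undef, neg_zero]
    intro h'
    apply h
    have h2 := h'.const_mul (γ * lam)⁻¹
    refine IntegrableOn.congr_fun h2 (fun s _ => ?_) measurableSet_Iic
    field_simp

/-- The absolutely continuous part of the stationary Ornstein–Uhlenbeck process. -/
noncomputable def ouDrift (γ lam : ℝ) (ω : PathSpace) (t : ℝ) : ℝ :=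
  -(γ * lam * Real.exp (-(lam * t)) * ∫ s in Iic t, Real.exp (lam * s) * ω s)

/-- Integration by substitution splits the stationary process into the rough part `γω` and a
differentiable remainder. Adding this remainder to the third coordinate later replaces the driver
`O` by `γω`. -/
lemma ouVar_shift (hlam : 0 < lam) {ω : PathSpace} (h : OUIntegrable lam ω) (t : ℝ) :
    ouVar γ lam (shift t ω) = γ * ω t + ouDrift γ lam ω t := by
  have h1 : ∫ s in Iic 0, Real.exp (lam * s) * ω (s + t) =
      Real.exp (-(lam * t)) * ∫ s in Iic t, Real.exp (lam * s) * ω s := by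
    rw [← (measurePreserving_add_right volume t).setIntegral_preimage_emb
      (measurableEmbedding_addRight t) (fun s => Real.exp (lam * s) * ω s) (Iic t), preimage_add_right_Iic, ← integral_const_mul]
    refine setIntegral_congr_fun measurableSet_Iic fun s _ => ?_
    rw [← mul_assoc, ← Real.exp_add]
    ring_nf
  have h2 : ∫ s in Iic (0 : ℝ), Real.exp (lam * s) * ω t = ω t / lam := by
    rw [integral_mul_const, integral_exp_mul_Iic hlam]
    simp; ring
  have h3 : ∫ s in Iic (0 : ℝ), γ * lam * Real.exp (lam * s) * shift t ω s =
      γ * lam * ((∫ s in Iic 0, Real.exp (lam * s) * ω (s + t)) -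
        ∫ s in Iic (0 : ℝ), Real.exp (lam * s) * ω t) := by
    rw [← integral_sub (h.integrableOn_add t)
      ((integrableOn_exp_mul_Iic hlam 0).mul_const (ω t)), ← integral_const_mul]
    refine setIntegral_congr_fun measurableSet_Iic fun s _ => ?_
    simp only [shift_apply]
    ring
  rw [ouVar, h3, h2, h1, ouDrift]
  field_simp
  ring

lemma hasDerivAt_ouDrift (hlam : 0 < lam) {ω : PathSpace} (h : OUIntegrable lam ω) (t : ℝ) :
    HasDerivAt (ouDrift γ lam ω) (-(lam * ouVar γ lam (shift t ω))) t := by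
  have hc : Continuous fun s => Real.exp (lam * s) * ω s := by
    have := ω.continuous_apply
    fun_prop
  have h1 : HasDerivAt (fun t => ∫ s in Iic t, Real.exp (lam * s) * ω s)
      (Real.exp (lam * t) * ω t) t := by
    have h2 : (fun t => ∫ s in Iic t, Real.exp (lam * s) * ω s) = fun t =>
        (∫ s in Iic 0, Real.exp (lam * s) * ω s) + ∫ s in (0)..t, Real.exp (lam * s) * ω s := by
      ext t
      rw [← intervalIntegral.integral_Iic_sub_Iic (h.integrableOn_Iic 0) (h.integrableOn_Iic t)]
      ring
    rw [h2]
    exact (intervalIntegral.integral_hasDerivAt_right (hc.intervalIntegrable _ _)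
      (hc.stronglyMeasurableAtFilter _ _) hc.continuousAt).const_add _
  have h3 : HasDerivAt (fun t : ℝ => Real.exp (-(lam * t)))
      (Real.exp (-(lam * t)) * (-lam)) t := by
    simpa using ((hasDerivAt_id t).const_mul lam).neg.exp
  have h4 := ((h3.const_mul (γ * lam)).mul h1).neg
  refine h4.congr_deriv ?_
  rw [ouVar_shift hlam h, ouDrift]
  have h5 : Real.exp (-(lam * t)) * Real.exp (lam * t) = 1 := by
    rw [← Real.exp_add]; simp
  linear_combination (-(γ * lam * ω t)) * h5

/-- Convergence of the integral is a shift-invariant property, so on an exceptional path the process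
is zero at all times. Continuity thus holds for every path, as a perfect cocycle requires. -/
lemma continuous_ouVar_shift (hlam : 0 < lam) (ω : PathSpace) :
    Continuous fun t => ouVar γ lam (shift t ω) := by
  by_cases h : OUIntegrable lam ω
  · simp_rw [ouVar_shift hlam h]
    exact (ω.continuous_apply.const_mul γ).add
      (continuous_iff_continuousAt.2 fun t => (hasDerivAt_ouDrift hlam h t).continuousAt)
  · have : ∀ t, ouVar γ lam (shift t ω) = 0 := fun t =>
      ouVar_of_not_ouIntegrable hlam fun h' => h ((ouIntegrable_shift_iff hlam t).1 h')
    simp_rw [this]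
    exact continuous_const

/-- The stationary Ornstein–Uhlenbeck process as a random continuous function. -/
noncomputable def ouPath (γ : ℝ) (hlam : 0 < lam) (ω : PathSpace) : C(ℝ, ℝ) :=
  ⟨fun t => ouVar γ lam (shift t ω), continuous_ouVar_shift hlam ω⟩

lemma ouPath_apply (hlam : 0 < lam) (ω : PathSpace) (t : ℝ) :
    ouPath γ hlam ω t = ouVar γ lam (shift t ω) := rfl

lemma ouPath_shift (hlam : 0 < lam) (ω : PathSpace) (s t : ℝ) :
    ouPath γ hlam (shift s ω) t = ouPath γ hlam ω (t + s) := by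
  rw [ouPath_apply, ouPath_apply, shift_add]

lemma measurable_ouPath (hlam : 0 < lam) : Measurable[_, borel C(ℝ, ℝ)] (ouPath γ hlam) :=
  ContinuousMap.measurable_of_eval fun t => measurable_ouVar.comp (measurable_shift_apply t)

end OU

/-! ### Sublinear growth along measure preserving maps -/

/-- Along measure preserving maps `T n`, an integrable function grows sublinearly. -/
lemma ae_tendsto_comp_div_atTop_zero {Ω : Type*} [MeasurableSpace Ω] {P : Measure Ω}
    [IsProbabilityMeasure P] {T : ℕ → Ω → Ω} (hT : ∀ n, MeasurePreserving (T n) P P) {X : Ω → ℝ}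
    (hXm : Measurable X) (hX : Integrable X P) (hX0 : 0 ≤ X) :
    ∀ᵐ ω ∂P, Tendsto (fun n : ℕ => X (T n ω) / n) atTop (𝓝 0) := by
  have h : ∀ k : ℕ, ∀ᵐ ω ∂P, ∀ᶠ n : ℕ in atTop, X (T n ω) ≤ n / ((k : ℝ) + 1) := fun k => by
    let _ : MeasureSpace Ω := ⟨P⟩
    have : IsProbabilityMeasure (volume : Measure Ω) := ‹IsProbabilityMeasure P›
    -- Integrability makes the tail probabilities of `(k + 1) X` summable. Measure preservation
    -- transfers this to `X ∘ T n`, and the first Borel–Cantelli lemma needs no independence.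
    have h1 := tsum_prob_mem_Ioi_lt_top (X := fun ω => ((k : ℝ) + 1) * X ω)
      (hX.const_mul _) fun ω => mul_nonneg (by positivity) (hX0 ω)
    have h2 : ∀ n : ℕ, P (T n ⁻¹' {ω | ((k : ℝ) + 1) * X ω ∈ Ioi (n : ℝ)}) =
        P {ω | ((k : ℝ) + 1) * X ω ∈ Ioi (n : ℝ)} := fun n =>
      (hT n).measure_preimage
        (measurableSet_lt measurable_const (hXm.const_mul _)).nullMeasurableSet
    have h3 : ∑' n : ℕ, P (T n ⁻¹' {ω | ((k : ℝ) + 1) * X ω ∈ Ioi (n : ℝ)}) ≠ ∞ := by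
      simp_rw [h2]
      exact h1.ne
    filter_upwards [ae_eventually_notMem h3] with ω hω
    filter_upwards [hω] with n hn
    have hn' : ¬ ((n : ℝ) < ((k : ℝ) + 1) * X (T n ω)) := hn
    rw [le_div_iff₀ (by positivity)]
    linarith [not_lt.1 hn']
  filter_upwards [ae_all_iff.2 h] with ω hω
  rw [Metric.tendsto_nhds]
  intro ε hε
  obtain ⟨k, hk⟩ := exists_nat_one_div_lt hε
  filter_upwards [hω k, eventually_gt_atTop 0] with n hn hn0
  have hn0' : (0 : ℝ) < n := by exact_mod_cast hn0
  rw [Real.dist_eq, sub_zero, abs_of_nonneg (div_nonneg (hX0 _) hn0'.le), div_lt_iff₀ hn0']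
  calc X (T n ω) ≤ n / ((k : ℝ) + 1) := hn
    _ = 1 / ((k : ℝ) + 1) * n := by ring
    _ < ε * n := mul_lt_mul_of_pos_right hk hn0'

/-! ### The two-sided Wiener measure -/

namespace IsWienerMeasure

open PathSpace

variable {P : Measure PathSpace}

/-- After a shift of its starting time, the coordinate process is a Brownian motion. -/
lemma isPreBrownianReal (hP : IsWienerMeasure P) (a : ℝ) :
    IsPreBrownianReal (fun (t : ℝ≥0) (ω : PathSpace) => ω (a + t) - ω a) P := by
  refine HasIndepIncrements.isPreBrownianReal_of_hasLaw (fun t => ?_) fun n t ht => ?_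
  · have := hP.increment_law a (a + t) (by simp)
    rwa [add_sub_cancel_left, Real.toNNReal_coe] at this
  · have := hP.indep_increments n (fun i => a + t i) fun i j hij =>
      add_le_add_right (NNReal.coe_le_coe.2 (ht hij)) a
    simpa only [sub_sub_sub_cancel_right] using this

lemma map_process_eq (hP : IsWienerMeasure P) (a b : ℝ) :
    P.map (fun ω (t : ℝ≥0) => ω (a + t) - ω a) = P.map (fun ω (t : ℝ≥0) => ω (b + t) - ω b) := by
  have := hP.isProbabilityMeasure
  have hm : ∀ a : ℝ, Measurable fun (ω : PathSpace) (t : ℝ≥0) => ω (a + t) - ω a := fun a =>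
    measurable_pi_lambda _ fun t => (measurable_eval _).sub (measurable_eval _)
  refine (map_eq_iff_forall_finset_map_restrict_eq (X := fun (t : ℝ≥0) (ω : PathSpace) =>
    ω (a + t) - ω a) (hm a).aemeasurable (hm b).aemeasurable).2 fun I => ?_
  exact ((hP.isPreBrownianReal a).hasLaw I).map_eq.trans
    ((hP.isPreBrownianReal b).hasLaw I).map_eq.symm

lemma measurePreserving_shift (hP : IsWienerMeasure P) (t : ℝ) :
    MeasurePreserving (shift t) P P := by
  have := hP.isProbabilityMeasure
  refine ⟨measurable_shift_apply t, ?_⟩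
  have hc : Measurable fun (ω : PathSpace) (s : ℝ) => ω s := comap_measurable _
  have key : P.map (fun ω s => shift t ω s) = P.map (fun ω (s : ℝ) => ω s) := by
    refine (map_eq_iff_forall_finset_map_restrict_eq (X := fun (s : ℝ) (ω : PathSpace) =>
      shift t ω s) (hc.comp (measurable_shift_apply t)).aemeasurable hc.aemeasurable).2 fun I => ?_
    -- Starting left of `0` and of all times in `I` reduces the two-sided process to Brownian
    -- motions on `[0, ∞)`: both finite-dimensional marginals are the same functional `G` of the
    -- increments after `a + t` and after `a`.
    obtain ⟨a, ha⟩ := (insert 0 I).bddBelow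
    have ha0 : a ≤ 0 := ha (by simp)
    have haI : ∀ i ∈ I, a ≤ i := fun i hi => ha (by simp [hi])
    set G : (ℝ≥0 → ℝ) → (I → ℝ) := fun b i => b ((i : ℝ) - a).toNNReal - b (-a).toNNReal
    have hG : Measurable G := by fun_prop
    have hm : ∀ a : ℝ, Measurable fun (ω : PathSpace) (t : ℝ≥0) => ω (a + t) - ω a := fun a =>
      measurable_pi_lambda _ fun t => (measurable_eval _).sub (measurable_eval _)
    have e := congrArg (Measure.map G) (hP.map_process_eq (a + t) a)
    rw [Measure.map_map hG (hm _), Measure.map_map hG (hm _)] at e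
    convert e using 2
    · ext ω i
      simp only [Finset.restrict, shift_apply, G, Function.comp]
      rw [Real.coe_toNNReal _ (sub_nonneg.2 (haI i i.2)), Real.coe_toNNReal _ (neg_nonneg.2 ha0)]
      ring_nf
    · ext ω i
      simp only [Finset.restrict, G, Function.comp]
      rw [Real.coe_toNNReal _ (sub_nonneg.2 (haI i i.2)), Real.coe_toNNReal _ (neg_nonneg.2 ha0)]
      simp [apply_zero]
  ext s hs
  obtain ⟨s', hs', rfl⟩ := hs
  have hcs : Measurable fun (ω : PathSpace) (s : ℝ) => shift t ω s :=
    hc.comp (measurable_shift_apply t)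
  have h2 : P.map (fun ω s => shift t ω s) s' = P.map (fun ω (s : ℝ) => ω s) s' := by rw [key]
  rw [Measure.map_apply hcs hs', Measure.map_apply hc hs'] at h2
  rw [Measure.map_apply (measurable_shift_apply t) (hc hs')]
  exact h2

lemma isMetricDynamicalSystem (hP : IsWienerMeasure P) : IsMetricDynamicalSystem P shift where
  isProbabilityMeasure := hP.isProbabilityMeasure
  measurable := measurable_shift
  map_zero := PathSpace.shift_zero
  map_add := PathSpace.shift_add
  measurePreserving := hP.measurePreserving_shift

lemma integrable_sq_sub (hP : IsWienerMeasure P) {s t : ℝ} (hst : s ≤ t) :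
    Integrable (fun ω : PathSpace => (ω t - ω s) ^ 2) P ∧ ∫ ω, (ω t - ω s) ^ 2 ∂P = t - s := by
  have := hP.isProbabilityMeasure
  have hl := hP.increment_law s t hst
  have hm := hl.hasGaussianLaw.memLp_two
  refine ⟨hm.integrable_sq, ?_⟩
  have h0 : ∫ ω : PathSpace, (ω t - ω s) ∂P = 0 := by
    rw [hl.integral_eq, integral_id_gaussianReal]
  rw [← variance_of_integral_eq_zero hl.aemeasurable h0, hl.variance_eq, variance_id_gaussianReal,
    Real.coe_toNNReal _ (sub_nonneg.2 hst)]

lemma integrable_sq_apply (hP : IsWienerMeasure P) (t : ℝ) :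
    Integrable (fun ω : PathSpace => ω t ^ 2) P ∧ ∫ ω : PathSpace, ω t ^ 2 ∂P = |t| := by
  rcases le_total 0 t with h | h
  · simpa [apply_zero, abs_of_nonneg h] using hP.integrable_sq_sub h
  · simpa [apply_zero, abs_of_nonpos h] using hP.integrable_sq_sub h

/-- Functionals of the increments over disjoint intervals of length `h` are independent. -/
lemma indepFun_comp_shift (hP : IsWienerMeasure P) {h a b : ℝ} (hh : 0 ≤ h) (hab : a + h ≤ b)
    {Y : PathSpace → ℝ} (hY : Measurable Y)
    (hY' : ∀ ω ω' : PathSpace, (∀ s ∈ Icc 0 h, ω s = ω' s) → Y ω = Y ω') :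
    IndepFun (fun ω => Y (shift a ω)) (fun ω => Y (shift b ω)) P := by
  have hclamp : ∀ s : ℝ, max 0 (min s h) ∈ Icc 0 h := fun s =>
    ⟨le_max_left _ _, max_le hh (min_le_right _ _)⟩
  -- Freezing the path outside `[0, h]` leaves `Y` unchanged and expresses it through increments
  -- over that interval alone. The Markov property at time `a + h` then gives independence.
  set frozen : PathSpace → PathSpace := fun ω =>
    ⟨⟨fun s => ω (max 0 (min s h)), ω.continuous_apply.comp (by fun_prop)⟩, by
      have : max 0 (min 0 h) = 0 := by rw [min_eq_left hh, max_self]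
      show ω (max 0 (min 0 h)) = 0
      rw [this, apply_zero]⟩
  have hfrozen : ∀ ω s, frozen ω s = ω (max 0 (min s h)) := fun _ _ => rfl
  have hYs : ∀ ω, Y (frozen ω) = Y ω := fun ω => hY' _ _ fun s hs => by
    rw [hfrozen, min_eq_left hs.2, max_eq_right hs.1]
  have key : IndepFun (fun ω (s : ℝ) => frozen (shift b ω) s) (fun ω (s : ℝ) => frozen (shift a ω) s) P := by
    set h' : ℝ≥0 := ⟨h, hh⟩
    have hh' : (h' : ℝ) = h := rfl
    set d : ℝ≥0 := ⟨b - a - h, by linarith⟩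
    have hd : (d : ℝ) = b - a - h := rfl
    have h1 := (hP.isPreBrownianReal a).indepFun_shift h'
    have h2 := h1.comp (φ := fun (x : ℝ≥0 → ℝ) (s : ℝ) => x (d + (max 0 (min s h)).toNNReal) - x d)
      (ψ := fun (x : Iic h' → ℝ) (s : ℝ) => x ⟨(max 0 (min s h)).toNNReal, by
        rw [mem_Iic, ← NNReal.coe_le_coe, Real.coe_toNNReal _ (hclamp s).1]
        exact (hclamp s).2⟩) (by fun_prop) (by fun_prop)
    convert h2 using 1
    · ext ω s
      simp only [hfrozen, shift_apply, Function.comp, NNReal.coe_add, hh', hd,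
        Real.coe_toNNReal _ (hclamp s).1]
      ring_nf
    · ext ω s
      simp only [hfrozen, shift_apply, Function.comp, Real.coe_toNNReal _ (hclamp s).1]
      ring_nf
  have key2 : IndepFun (fun ω => frozen (shift b ω)) (fun ω => frozen (shift a ω)) P := by
    rw [IndepFun_iff_Indep] at key ⊢
    have e : ∀ f : PathSpace → PathSpace, MeasurableSpace.comap f inferInstance =
        MeasurableSpace.comap (fun ω (s : ℝ) => f ω s) MeasurableSpace.pi := fun f =>
      MeasurableSpace.comap_comp
    rwa [e, e]
  have h3 := (key2.comp hY hY).symm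
  simpa [Function.comp_def, hYs] using h3

/-- The strong law of large numbers for functionals of the path over consecutive intervals. -/
lemma ae_tendsto_sum_comp_shift_div (hP : IsWienerMeasure P) {h : ℝ} (hh : 0 ≤ h)
    {Y : PathSpace → ℝ} (hY : Measurable Y) (hYi : Integrable Y P)
    (hY' : ∀ ω ω' : PathSpace, (∀ s ∈ Icc 0 h, ω s = ω' s) → Y ω = Y ω') :
    ∀ᵐ ω ∂P, Tendsto (fun n : ℕ => (∑ i ∈ Finset.range n, Y (shift (-((i + 1) * h)) ω)) / n) atTop
      (𝓝 (∫ ω, Y ω ∂P)) := by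
  have hid : ∀ t, IdentDistrib (fun ω => Y (shift t ω)) Y P P := fun t =>
    ⟨(hY.comp (measurable_shift_apply t)).aemeasurable, hY.aemeasurable, by
      conv_rhs => rw [← (hP.measurePreserving_shift t).map_eq]
      rw [Measure.map_map hY (measurable_shift_apply t)]
      rfl⟩
  have h1 := strong_law_ae_real (μ := P) (fun (i : ℕ) ω => Y (shift (-((i + 1) * h)) ω))
    ((hid _).symm.integrable_snd hYi) (fun i j hij => by
      have hlt : ∀ i j : ℕ, i < j → IndepFun (fun ω => Y (shift (-((j + 1) * h)) ω))
          (fun ω => Y (shift (-((i + 1) * h)) ω)) P := fun i j hij => by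
        refine hP.indepFun_comp_shift hh ?_ hY hY'
        have : (i : ℝ) + 1 ≤ j := by exact_mod_cast hij
        nlinarith [mul_le_mul_of_nonneg_right this hh]
      rcases lt_or_gt_of_ne hij with h | h
      · exact (hlt i j h).symm
      · exact hlt j i h) fun i => (hid _).trans (hid _).symm
  rwa [(hid _).integral_eq] at h1

end IsWienerMeasure

/-! ### Moments of path integrals -/

section Moments

open PathSpace

variable {P : Measure PathSpace} {γ lam : ℝ}

/-- Half of the exponential rate pays for the linear factor. -/
lemma integrableOn_exp_mul_abs_Iic (hlam : 0 < lam) :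
    IntegrableOn (fun s => Real.exp (lam * s) * |s|) (Iic 0) := by
  have h := (integrableOn_exp_mul_Iic (half_pos hlam) 0).const_mul (2 / lam)
  refine h.mono' (by fun_prop) ?_
  filter_upwards [ae_restrict_mem measurableSet_Iic] with s hs
  rw [Real.norm_eq_abs, abs_mul, abs_abs, abs_of_pos (Real.exp_pos _), abs_of_nonpos hs]
  have h1 : -s ≤ 2 / lam * Real.exp (-(lam / 2 * s)) := by
    have := Real.add_one_le_exp (-(lam / 2 * s))
    rw [div_mul_eq_mul_div, le_div_iff₀ hlam]
    linarith
  have h2 : Real.exp (lam * s) = Real.exp (lam / 2 * s) * Real.exp (lam / 2 * s) := by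
    rw [← Real.exp_add]; ring_nf
  have h3 : Real.exp (lam / 2 * s) * Real.exp (-(lam / 2 * s)) = 1 := by
    rw [← Real.exp_add]; simp
  calc Real.exp (lam * s) * -s ≤ Real.exp (lam * s) * (2 / lam * Real.exp (-(lam / 2 * s))) :=
        mul_le_mul_of_nonneg_left h1 (Real.exp_pos _).le
    _ = 2 / lam * (Real.exp (lam / 2 * s) * (Real.exp (lam / 2 * s) * Real.exp (-(lam / 2 * s)))) := by
        rw [h2]; ring
    _ = _ := by rw [h3, mul_one]

lemma IsWienerMeasure.integrable_prod_exp_mul_sq (hP : IsWienerMeasure P) (hlam : 0 < lam) :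
    Integrable (fun p : ℝ × PathSpace => Real.exp (lam * p.1) * p.2 p.1 ^ 2)
      ((volume.restrict (Iic 0)).prod P) := by
  have := hP.isProbabilityMeasure
  have hm := measurable_apply
  rw [integrable_prod_iff (Measurable.aestronglyMeasurable (by fun_prop))]
  refine ⟨Eventually.of_forall fun s =>
    (hP.integrable_sq_apply s).1.const_mul (Real.exp (lam * s)), ?_⟩
  refine (integrableOn_exp_mul_abs_Iic hlam).congr (Eventually.of_forall fun s => ?_)
  simp only [norm_mul, Real.norm_eq_abs, Real.abs_exp, abs_pow, sq_abs]
  rw [integral_const_mul, (hP.integrable_sq_apply s).2]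

/-- This is Jensen's inequality for the probability density `lam * exp (lam s)` on the negative
half-line, obtained from nonnegativity of the variance about the mean `lam * I`. -/
lemma ouVar_sq_le (hlam : 0 < lam) {ω : PathSpace}
    (h2 : IntegrableOn (fun s => Real.exp (lam * s) * ω s ^ 2) (Iic 0))
    (h1 : OUIntegrable lam ω) :
    ouVar γ lam ω ^ 2 ≤ γ ^ 2 * lam * ∫ s in Iic 0, Real.exp (lam * s) * ω s ^ 2 := by
  set I := ∫ s in Iic 0, Real.exp (lam * s) * ω s with hI
  have hO : ouVar γ lam ω = -(γ * lam * I) := by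
    rw [ouVar, hI, ← integral_const_mul]
    simp only [mul_assoc]
  have h0 : ∫ s in Iic (0 : ℝ), Real.exp (lam * s) = 1 / lam := by
    rw [integral_exp_mul_Iic hlam]; simp
  have hpos : 0 ≤ ∫ s in Iic 0, Real.exp (lam * s) * (ω s - lam * I) ^ 2 :=
    integral_nonneg fun s => by positivity
  have hgen : ∀ m : ℝ, ∫ s in Iic 0, Real.exp (lam * s) * (ω s - m) ^ 2 =
      (∫ s in Iic 0, Real.exp (lam * s) * ω s ^ 2) - 2 * m * I + m ^ 2 * (1 / lam) := fun m => by
    have h3 : IntegrableOn (fun s => 2 * m * (Real.exp (lam * s) * ω s)) (Iic 0) := h1.const_mul _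
    have h4 : IntegrableOn (fun s => m ^ 2 * Real.exp (lam * s)) (Iic 0) :=
      (integrableOn_exp_mul_Iic hlam 0).const_mul _
    have h5 : IntegrableOn (fun s => Real.exp (lam * s) * ω s ^ 2
      - 2 * m * (Real.exp (lam * s) * ω s)) (Iic 0) := h2.sub h3
    rw [← h0, hI, ← integral_const_mul, ← integral_const_mul, ← integral_sub h2 h3,
      ← integral_add h5 h4]
    refine setIntegral_congr_fun measurableSet_Iic fun s _ => ?_
    ring
  have hexp := hgen (lam * I)
  rw [hexp] at hpos
  have h3 : (lam * I) ^ 2 * (1 / lam) = lam * I * I := by field_simp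
  rw [h3] at hpos
  rw [hO]
  have h4 : lam * I * I ≤ ∫ s in Iic 0, Real.exp (lam * s) * ω s ^ 2 := by linarith
  have h5 := mul_le_mul_of_nonneg_left h4 (by positivity : 0 ≤ γ ^ 2 * lam)
  linarith

lemma IsWienerMeasure.ae_integrable_exp_mul_sq (hP : IsWienerMeasure P) (hlam : 0 < lam) :
    ∀ᵐ ω ∂P, IntegrableOn (fun s => Real.exp (lam * s) * ω s ^ 2) (Iic 0) := by
  have := hP.isProbabilityMeasure
  have h := (hP.integrable_prod_exp_mul_sq hlam).swap
  exact h.prod_right_ae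

lemma IsWienerMeasure.ae_ouIntegrable (hP : IsWienerMeasure P) (hlam : 0 < lam) :
    ∀ᵐ ω ∂P, OUIntegrable lam ω := by
  filter_upwards [hP.ae_integrable_exp_mul_sq hlam] with ω hω
  have hc := ω.continuous_apply
  refine (hω.add (integrableOn_exp_mul_Iic hlam 0)).mono'
    ((by fun_prop : Continuous fun s => Real.exp (lam * s) * ω s).aestronglyMeasurable) ?_
  refine Eventually.of_forall fun s => ?_
  rw [Real.norm_eq_abs, abs_mul, Real.abs_exp, Pi.add_apply, ← mul_add_one]
  refine mul_le_mul_of_nonneg_left ?_ (Real.exp_pos _).le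
  rw [← sq_abs]
  nlinarith [sq_nonneg (|ω s| - 1), abs_nonneg (ω s)]

lemma IsWienerMeasure.integrable_ouVar_sq (hP : IsWienerMeasure P) (hlam : 0 < lam) :
    Integrable (fun ω => ouVar γ lam ω ^ 2) P := by
  have := hP.isProbabilityMeasure
  have h := ((hP.integrable_prod_exp_mul_sq hlam).integral_prod_right).const_mul (γ ^ 2 * lam)
  refine h.mono' (measurable_ouVar.pow_const 2).aestronglyMeasurable ?_
  filter_upwards [hP.ae_integrable_exp_mul_sq hlam, hP.ae_ouIntegrable hlam] with ω h1 h2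
  rw [Real.norm_eq_abs, abs_of_nonneg (sq_nonneg _)]
  exact ouVar_sq_le hlam h1 h2

/-- The energy of the Ornstein–Uhlenbeck path over `[0, h]`. -/
noncomputable def ouCellEnergy (γ lam h : ℝ) (ω : PathSpace) : ℝ :=
  ∫ s in (0)..h, ouVar γ lam (shift s ω) ^ 2

lemma measurable_ouCellEnergy {h : ℝ} (hh : 0 ≤ h) : Measurable (ouCellEnergy γ lam h) := by
  unfold ouCellEnergy
  simp only [intervalIntegral.integral_of_le hh]
  refine (StronglyMeasurable.integral_prod_left
    (f := fun (s : ℝ) (ω : PathSpace) => ouVar γ lam (shift s ω) ^ 2)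
    (Measurable.stronglyMeasurable ?_)).measurable
  exact (measurable_ouVar.comp measurable_shift).pow_const 2

lemma ouCellEnergy_nonneg {h : ℝ} (hh : 0 ≤ h) (ω : PathSpace) : 0 ≤ ouCellEnergy γ lam h ω :=
  intervalIntegral.integral_nonneg hh fun _ _ => sq_nonneg _

/-- By stationarity the second moment is constant in time. Only finiteness is needed, for the growth
of the error from an incomplete first cell. -/
lemma IsWienerMeasure.integrable_ouCellEnergy (hP : IsWienerMeasure P) (hlam : 0 < lam) {h : ℝ}
    (hh : 0 ≤ h) : Integrable (ouCellEnergy γ lam h) P := by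
  have := hP.isProbabilityMeasure
  have hm : Measurable fun p : ℝ × PathSpace => ouVar γ lam (shift p.1 p.2) ^ 2 :=
    (measurable_ouVar.comp measurable_shift).pow_const 2
  have hi : ∀ s, Integrable (fun ω => ouVar γ lam (shift s ω) ^ 2) P ∧
      ∫ ω, ouVar γ lam (shift s ω) ^ 2 ∂P = ∫ ω, ouVar γ lam ω ^ 2 ∂P := fun s =>
    ⟨(hP.measurePreserving_shift s).integrable_comp_of_integrable (hP.integrable_ouVar_sq hlam), by
      conv_rhs => rw [← (hP.measurePreserving_shift s).map_eq]
      rw [integral_map (measurable_shift_apply s).aemeasurable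
        (measurable_ouVar.pow_const 2).aestronglyMeasurable]⟩
  have h1 : Integrable (fun p : ℝ × PathSpace => ouVar γ lam (shift p.1 p.2) ^ 2)
      ((volume.restrict (Ioc 0 h)).prod P) := by
    rw [integrable_prod_iff hm.aestronglyMeasurable]
    refine ⟨Eventually.of_forall fun s => (hi s).1, ?_⟩
    simp only [norm_pow, Real.norm_eq_abs, sq_abs, (hi _).2]
    exact integrable_const _
  have h2 := h1.integral_prod_right
  unfold ouCellEnergy
  simpa only [intervalIntegral.integral_of_le hh] using h2

/-- The energy of the noise path over `[0, h]`. -/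
noncomputable def noiseCellEnergy (γ h : ℝ) (ω : PathSpace) : ℝ := ∫ s in (0)..h, (γ * ω s) ^ 2

lemma measurable_noiseCellEnergy {h : ℝ} (hh : 0 ≤ h) : Measurable (noiseCellEnergy γ h) := by
  unfold noiseCellEnergy
  simp only [intervalIntegral.integral_of_le hh]
  refine (StronglyMeasurable.integral_prod_left
    (f := fun (s : ℝ) (ω : PathSpace) => (γ * ω s) ^ 2)
    (Measurable.stronglyMeasurable ?_)).measurable
  exact (measurable_apply.const_mul γ).pow_const 2

lemma noiseCellEnergy_nonneg {h : ℝ} (hh : 0 ≤ h) (ω : PathSpace) : 0 ≤ noiseCellEnergy γ h ω :=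
  intervalIntegral.integral_nonneg hh fun _ _ => sq_nonneg _

lemma noiseCellEnergy_congr {h : ℝ} (hh : 0 ≤ h) {ω ω' : PathSpace}
    (hω : ∀ s ∈ Icc 0 h, ω s = ω' s) : noiseCellEnergy γ h ω = noiseCellEnergy γ h ω' :=
  intervalIntegral.integral_congr fun s hs => by
    rw [uIcc_of_le hh] at hs
    simp only [hω s hs]

/-- The mean is of order `h²` because Brownian motion starts from `0` in each cell; this is what
lets the linear dissipation win for short cells. -/
lemma IsWienerMeasure.integrable_noiseCellEnergy (hP : IsWienerMeasure P) {h : ℝ} (hh : 0 ≤ h) :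
    Integrable (noiseCellEnergy γ h) P ∧ ∫ ω, noiseCellEnergy γ h ω ∂P = γ ^ 2 * h ^ 2 / 2 := by
  have := hP.isProbabilityMeasure
  have hm : Measurable fun p : ℝ × PathSpace => (γ * p.2 p.1) ^ 2 :=
    (measurable_apply.const_mul γ).pow_const 2
  have hi : ∀ s, Integrable (fun ω : PathSpace => (γ * ω s) ^ 2) P ∧
      ∫ ω : PathSpace, (γ * ω s) ^ 2 ∂P = γ ^ 2 * |s| := fun s => by
    simp only [mul_pow]
    exact ⟨(hP.integrable_sq_apply s).1.const_mul _, by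
      rw [integral_const_mul, (hP.integrable_sq_apply s).2]⟩
  have h1 : Integrable (fun p : ℝ × PathSpace => (γ * p.2 p.1) ^ 2)
      ((volume.restrict (Ioc 0 h)).prod P) := by
    rw [integrable_prod_iff hm.aestronglyMeasurable]
    refine ⟨Eventually.of_forall fun s => (hi s).1, ?_⟩
    simp only [norm_pow, Real.norm_eq_abs, sq_abs, (hi _).2]
    exact (by fun_prop : Continuous fun s : ℝ => γ ^ 2 * |s|).integrableOn_Ioc
  unfold noiseCellEnergy
  simp only [intervalIntegral.integral_of_le hh]
  refine ⟨h1.integral_prod_right, ?_⟩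
  rw [integral_integral_swap (f := fun (ω : PathSpace) (s : ℝ) => (γ * ω s) ^ 2) h1.swap]
  simp only [(hi _).2]
  rw [← intervalIntegral.integral_of_le hh]
  have : ∫ s in (0)..h, γ ^ 2 * |s| = ∫ s in (0)..h, γ ^ 2 * s :=
    intervalIntegral.integral_congr fun s hs => by
      rw [uIcc_of_le hh] at hs
      simp only [abs_of_nonneg hs.1]
  rw [this, intervalIntegral.integral_const_mul, integral_id]
  ring

end Moments

/-! ### Pullback attractors from forward invariant absorbing sets -/

section Attractor

/-- A point in every image has nested nonempty compact fibres in the `K n`, which share a point. -/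
lemma image_iInter_of_antitone_of_isCompact {E F : Type*} [TopologicalSpace E] [T2Space E]
    [TopologicalSpace F] [T1Space F] {f : E → F} (hf : Continuous f) {K : ℕ → Set E}
    (hK : Antitone K) (hc : ∀ n, IsCompact (K n)) : f '' (⋂ n, K n) = ⋂ n, f '' K n := by
  refine (image_iInter_subset _ _).antisymm fun y hy => ?_
  have hcl : IsClosed (f ⁻¹' {y}) := isClosed_singleton.preimage hf
  obtain ⟨x, hx⟩ := IsCompact.nonempty_iInter_of_sequence_nonempty_isCompact_isClosed
    (fun n => K n ∩ f ⁻¹' {y}) (fun n => inter_subset_inter_left _ (hK n.le_succ))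
    (fun n => by
      obtain ⟨x, hx, hxy⟩ := mem_iInter.1 hy n
      exact ⟨x, hx, hxy⟩) ((hc 0).inter_right hcl) fun n => (hc n).isClosed.inter hcl
  rw [mem_iInter] at hx
  exact ⟨x, mem_iInter.2 fun n => (hx n).1, (hx 0).2⟩

variable {Ω E : Type*} [MeasurableSpace Ω] {P : Measure Ω} {θ : ℝ → Ω → Ω}

namespace IsMetricDynamicalSystem

lemma comp_neg (h : IsMetricDynamicalSystem P θ) (t : ℝ) (ω : Ω) : θ t (θ (-t) ω) = ω := by
  rw [← h.map_add, add_neg_cancel, h.map_zero]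

lemma neg_comp (h : IsMetricDynamicalSystem P θ) (t : ℝ) (ω : Ω) : θ (-t) (θ t ω) = ω := by
  rw [← h.map_add, neg_add_cancel, h.map_zero]

lemma comm (h : IsMetricDynamicalSystem P θ) (s t : ℝ) (ω : Ω) : θ s (θ t ω) = θ t (θ s ω) := by
  rw [← h.map_add, ← h.map_add, add_comm]

lemma ae_comp (h : IsMetricDynamicalSystem P θ) (t : ℝ) {p : Ω → Prop} (hp : ∀ᵐ ω ∂P, p ω) :
    ∀ᵐ ω ∂P, p (θ t ω) :=
  (h.measurePreserving t).quasiMeasurePreserving.ae hp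

lemma iterate (h : IsMetricDynamicalSystem P θ) (t : ℝ) (n : ℕ) (ω : Ω) :
    (θ t)^[n] ω = θ (n * t) ω := by
  induction n generalizing ω with
  | zero => simp [h.map_zero]
  | succ n ih =>
    rw [Function.iterate_succ_apply, ih, ← h.map_add]
    push_cast
    ring_nf

end IsMetricDynamicalSystem

/-- The complement of the closed ball is a union of countably many small balls with dense centres;
avoiding each of them is a condition on the distance from its centre, the only measurable data
available. -/
lemma IsRandomCompactSet.measurableSet_subset_closedBall [MetricSpace E]
    [SecondCountableTopology E] {A : Ω → Set E} (hA : IsRandomCompactSet A) (x : E) (r : ℝ) :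
    MeasurableSet {ω | A ω ⊆ Metric.closedBall x r} := by
  have : Nonempty E := ⟨x⟩
  set q := TopologicalSpace.denseSeq E
  have key : {ω | A ω ⊆ Metric.closedBall x r} = ⋂ (i : ℕ) (k : ℕ)
      (_ : Metric.ball (q i) (1 / ((k : ℝ) + 1)) ⊆ (Metric.closedBall x r)ᶜ),
      {ω | 1 / ((k : ℝ) + 1) ≤ Metric.infDist (q i) (A ω)} := by
    ext ω
    simp only [mem_iInter]
    constructor
    · intro h i k hik
      by_contra hlt
      have hlt' : Metric.infDist (q i) (A ω) < 1 / ((k : ℝ) + 1) := not_le.1 hlt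
      obtain ⟨y, hy, hyd⟩ := (Metric.infDist_lt_iff (hA.nonempty ω)).1 hlt'
      exact hik (Metric.mem_ball'.2 hyd) (h hy)
    · intro h y hy
      by_contra hyc
      obtain ⟨ε, hε, hball⟩ := Metric.isOpen_iff.1 Metric.isClosed_closedBall.isOpen_compl y hyc
      obtain ⟨k, hk⟩ := exists_nat_one_div_lt (half_pos hε)
      have hk0 : 0 < 1 / ((k : ℝ) + 1) := by positivity
      obtain ⟨i, hi⟩ := (TopologicalSpace.denseRange_denseSeq E).exists_dist_lt y hk0
      have h1 := h i k (fun z hz => hball (by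
        have h2 := dist_triangle z (q i) y
        rw [Metric.mem_ball] at hz ⊢
        rw [dist_comm (q i) y] at h2
        have h3 : dist y (q i) < 1 / ((k : ℝ) + 1) := hi
        linarith))
      have h2 : 1 / ((k : ℝ) + 1) ≤ Metric.infDist (q i) (A ω) := h1
      have h3 := Metric.infDist_le_dist_of_mem (x := q i) hy
      rw [dist_comm] at h3
      have h4 : dist y (q i) < 1 / ((k : ℝ) + 1) := hi
      linarith
  rw [key]
  exact MeasurableSet.iInter fun i => MeasurableSet.iInter fun k => MeasurableSet.iInter fun _ =>
    measurableSet_le measurable_const (hA.measurable_infDist _)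

variable [MetricSpace E] {φ : ℝ≥0 → Ω → E → E}

/-- A pullback attractor attracts along the multiples of a positive time. -/
lemma IsPullbackAttractor.ae_tendsto_natMul {A : Ω → Set E} (hA : IsPullbackAttractor P θ φ A)
    {τ : ℝ≥0} (hτ : 0 < τ) {B : Set E} (hB : IsCompact B) :
    ∀ᵐ ω ∂P, Tendsto (fun n : ℕ => ⨆ y ∈ B,
      Metric.infEDist (φ (n * τ) (θ (-(n * τ)) ω) y) (A ω)) atTop (𝓝 0) := by
  filter_upwards [hA.attracts B hB] with ω hω
  have ht : Tendsto (fun n : ℕ => (n : ℝ≥0) * τ) atTop atTop :=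
    tendsto_natCast_atTop_atTop.atTop_mul_const hτ
  simpa [Function.comp_def] using hω.comp ht

variable [MeasurableSpace E]

namespace IsRDS

/-- Invariance at the single time `τ` is iterated backwards along the orbit, on one full-measure set
valid for all `n`. -/
lemma ae_image_natMul_eq (h : IsRDS P θ φ) {τ : ℝ≥0} {A : Ω → Set E}
    (hA : ∀ᵐ ω ∂P, φ τ ω '' A ω = A (θ τ ω)) :
    ∀ᵐ ω ∂P, ∀ n : ℕ, φ (n * τ) (θ (-(n * τ)) ω) '' A (θ (-(n * τ)) ω) = A ω := by
  have h1 : ∀ᵐ ω ∂P, ∀ n : ℕ, φ τ (θ (-((n + 1) * τ)) ω) '' A (θ (-((n + 1) * τ)) ω) =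
      A (θ (-(n * τ)) ω) := ae_all_iff.2 fun n => by
    filter_upwards [h.base.ae_comp (-((n + 1) * τ)) hA] with ω hω
    rw [hω, ← h.base.map_add]
    ring_nf
  filter_upwards [h1] with ω hω n
  induction n with
  | zero =>
    have : φ 0 ω = id := funext (h.map_zero ω)
    simp [h.base.map_zero, this]
  | succ n ih =>
    have e : φ ((n + 1 : ℕ) * τ) (θ (-((n + 1 : ℕ) * τ)) ω) =
        φ (n * τ) (θ (-(n * τ)) ω) ∘ φ τ (θ (-((n + 1) * τ)) ω) := by
      ext x
      have := h.cocycle τ (n * τ) (θ (-((n + 1) * τ)) ω) x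
      rw [← h.base.map_add] at this
      rw [Function.comp, show (((n + 1 : ℕ) : ℝ≥0)) * τ = n * τ + τ by push_cast; ring]
      convert this using 3 <;> push_cast <;> ring_nf
    rw [e, image_comp]
    push_cast
    rw [hω n, ih]

/-- By Poincaré recurrence, an invariant random set that is bounded in a measurable way is
contained in any random set attracting all balls. -/
lemma ae_subset_of_attracts (h : IsRDS P θ φ) {τ : ℝ≥0} {A A' : Ω → Set E} (x : E)
    (hcl : ∀ ω, IsClosed (A ω))
    (hattr : ∀ m : ℕ, ∀ᵐ ω ∂P, Tendsto (fun n : ℕ => ⨆ y ∈ Metric.closedBall x m,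
      Metric.infEDist (φ (n * τ) (θ (-(n * τ)) ω) y) (A ω)) atTop (𝓝 0))
    (hinv : ∀ᵐ ω ∂P, φ τ ω '' A' ω = A' (θ τ ω)) {S : ℕ → Set Ω} (hS : ∀ m, MeasurableSet (S m))
    (hSA : ∀ m, ∀ ω ∈ S m, A' ω ⊆ Metric.closedBall x m) (hSP : ∀ᵐ ω ∂P, ∃ m, ω ∈ S m) :
    ∀ᵐ ω ∂P, A' ω ⊆ A ω := by
  have := h.base.isProbabilityMeasure
  have hrec : ∀ m, ∀ᵐ ω ∂P, ω ∈ S m → ∃ᶠ n in atTop, (θ (-τ))^[n] ω ∈ S m := fun m =>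
    (h.base.measurePreserving (-τ)).conservative.ae_mem_imp_frequently_image_mem
      (hS m).nullMeasurableSet
  filter_upwards [ae_all_iff.2 hattr, h.ae_image_natMul_eq hinv, ae_all_iff.2 hrec, hSP]
    with ω h1 h2 h3 ⟨m, hm⟩ y hy
  rw [← (hcl ω).closure_eq, Metric.mem_closure_iff_infEDist_zero]
  by_contra hne
  have hlt := (h1 m).eventually (gt_mem_nhds (pos_iff_ne_zero.2 hne))
  -- At a late return time `n` the past fibre of `A'` lies in the ball of radius `m`, whose image is
  -- already closer to `A ω` than `y` is. But `y` belongs to that image by invariance.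
  obtain ⟨n, hn1, hn2⟩ := ((h3 m hm).and_eventually hlt).exists
  rw [h.base.iterate, mul_neg] at hn1
  rw [← h2 n] at hy
  obtain ⟨z, hz, rfl⟩ := hy
  refine absurd hn2 (not_lt.2 ?_)
  exact le_iSup₂ (f := fun y (_ : y ∈ Metric.closedBall x m) =>
    Metric.infEDist (φ (n * τ) (θ (-(n * τ)) ω) y) (A ω)) z (hSA m _ hn1 hz)

end IsRDS

lemma IsPullbackAttractor.ae_subset [ProperSpace E] (h : IsRDS P θ φ) (x : E) {A A' : Ω → Set E}
    (hA : IsPullbackAttractor P θ φ A) (hA' : IsPullbackAttractor P θ φ A') :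
    ∀ᵐ ω ∂P, A' ω ⊆ A ω := by
  refine h.ae_subset_of_attracts (τ := 1) (S := fun m => {ω | A' ω ⊆ Metric.closedBall x m}) x
    (fun ω => (hA.randomCompact.isCompact ω).isClosed)
    (fun m => hA.ae_tendsto_natMul one_pos (isCompact_closedBall x m)) (hA'.invariant 1)
    (fun m => hA'.randomCompact.measurableSet_subset_closedBall x m) (fun m ω hω => hω)
    (Eventually.of_forall fun ω => ?_)
  obtain ⟨r, hr⟩ := ((hA'.randomCompact.isCompact ω).isBounded.subset_closedBall x)
  obtain ⟨m, hm⟩ := exists_nat_ge r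
  exact ⟨m, hr.trans (Metric.closedBall_subset_closedBall hm)⟩

/-- Pullback attractors are unique up to null sets. -/
lemma IsPullbackAttractor.ae_eq [ProperSpace E] (h : IsRDS P θ φ) (x : E) {A A' : Ω → Set E}
    (hA : IsPullbackAttractor P θ φ A) (hA' : IsPullbackAttractor P θ φ A') :
    ∀ᵐ ω ∂P, A' ω = A ω := by
  filter_upwards [hA.ae_subset h x hA', hA'.ae_subset h x hA] with ω h1 h2
  exact h1.antisymm h2

/-! ### Existence of the attractor as an intersection of pulled-back absorbing sets. -/

section Existence

variable {D : Type*} [TopologicalSpace D]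

/-- The image at time `0` of the set `range (b (θ_{-nτ} ω))`. -/
def pullbackSection (θ : ℝ → Ω → Ω) (φ : ℝ≥0 → Ω → E → E) (τ : ℝ≥0) (b : Ω → D → E) (n : ℕ)
    (ω : Ω) : Set E :=
  range fun d => φ (n * τ) (θ (-(n * τ)) ω) (b (θ (-(n * τ)) ω) d)

variable {τ : ℝ≥0} {b : Ω → D → E}

lemma IsRDS.isCompact_pullbackSection [CompactSpace D] (h : IsRDS P θ φ)
    (hb : ∀ ω, Continuous (b ω)) (n : ℕ) (ω : Ω) : IsCompact (pullbackSection θ φ τ b n ω) :=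
  isCompact_range ((h.continuous _ _).comp (hb _))

/-- Parametrizing the set continuously by a separable space reduces the distance to countably many
measurable distances. -/
lemma IsRDS.measurable_infDist_pullbackSection [Nonempty D] [TopologicalSpace.SeparableSpace D]
    [BorelSpace E] [SecondCountableTopology E] (h : IsRDS P θ φ) (hb : ∀ ω, Continuous (b ω))
    (hbm : ∀ d, Measurable fun ω => b ω d) (n : ℕ) (x : E) :
    Measurable fun ω => Metric.infDist x (pullbackSection θ φ τ b n ω) := by
  refine measurable_of_Iio fun c => ?_
  have key : (fun ω => Metric.infDist x (pullbackSection θ φ τ b n ω)) ⁻¹' Iio c =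
      ⋃ i : ℕ, {ω | dist x (φ (n * τ) (θ (-(n * τ)) ω)
        (b (θ (-(n * τ)) ω) (TopologicalSpace.denseSeq D i))) < c} := by
    ext ω
    simp only [mem_preimage, mem_Iio, mem_iUnion]
    rw [pullbackSection, Metric.infDist_lt_iff (range_nonempty _)]
    constructor
    · rintro ⟨_, ⟨d, rfl⟩, hd⟩
      have ho : IsOpen {d | dist x (φ (n * τ) (θ (-(n * τ)) ω) (b (θ (-(n * τ)) ω) d)) < c} :=
        isOpen_lt (continuous_const.dist ((h.continuous _ _).comp (hb _))) continuous_const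
      obtain ⟨i, hi⟩ := (TopologicalSpace.denseRange_denseSeq D).exists_mem_open ho ⟨d, hd⟩
      exact ⟨i, hi⟩
    · rintro ⟨i, hi⟩
      exact ⟨_, ⟨_, rfl⟩, hi⟩
  rw [key]
  refine MeasurableSet.iUnion fun i => measurableSet_lt ?_ measurable_const
  have h1 : Measurable (θ (-(n * τ))) := (h.base.measurePreserving _).measurable
  have h2 : Measurable fun ω => ((n * τ : ℝ≥0), θ (-(n * τ)) ω,
      b (θ (-(n * τ)) ω) (TopologicalSpace.denseSeq D i)) :=
    measurable_const.prodMk (h1.prodMk ((hbm _).comp h1))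
  exact measurable_const.dist (h.measurable.comp h2)

/-- A random dynamical system with a forward invariant (at time `τ`), absorbing random compact set
has a pullback attractor. -/
theorem IsRDS.exists_isPullbackAttractor [Nonempty D] [TopologicalSpace.SeparableSpace D]
    [CompactSpace D] [BorelSpace E] [ProperSpace E] (h : IsRDS P θ φ) (x : E) (hτ : 0 < τ)
    (hb : ∀ ω, Continuous (b ω)) (hbm : ∀ d, Measurable fun ω => b ω d)
    (hfwd : ∀ᵐ ω ∂P, ∀ d, φ τ ω (b ω d) ∈ range (b (θ τ ω)))
    (habs : ∀ B : Set E, IsCompact B → ∀ᵐ ω ∂P, ∀ᶠ t : ℝ≥0 in atTop, ∀ y ∈ B,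
      φ t (θ (-(t : ℝ)) ω) y ∈ range (b ω)) :
    ∃ A : Ω → Set E, IsPullbackAttractor P θ φ A := by
  have := h.base.isProbabilityMeasure
  set K := pullbackSection θ φ τ b with hKd
  have hKc : ∀ n ω, IsCompact (K n ω) := fun n ω => h.isCompact_pullbackSection hb n ω
  have hKne : ∀ n ω, (K n ω).Nonempty := fun n ω => range_nonempty _
  have hanti : ∀ᵐ ω ∂P, Antitone fun n => K n ω := by
    have h1 : ∀ᵐ ω ∂P, ∀ n : ℕ, ∀ d, φ τ (θ (-((n + 1) * τ)) ω) (b (θ (-((n + 1) * τ)) ω) d) ∈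
        range (b (θ (-(n * τ)) ω)) := ae_all_iff.2 fun n => by
      filter_upwards [h.base.ae_comp (-((n + 1) * τ)) hfwd] with ω hω
      rw [← h.base.map_add] at hω
      convert hω using 5
      ring
    filter_upwards [h1] with ω hω
    refine antitone_nat_of_succ_le fun n => ?_
    rintro _ ⟨d, rfl⟩
    obtain ⟨d', hd'⟩ := hω n d
    refine ⟨d', ?_⟩
    have := h.cocycle τ (n * τ) (θ (-((n + 1) * τ)) ω) (b (θ (-((n + 1) * τ)) ω) d)
    rw [← h.base.map_add] at this
    simp only
    rw [hd', show (((n + 1 : ℕ) : ℝ≥0)) * τ = n * τ + τ by push_cast; ring]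
    convert this.symm using 3 <;> push_cast <;> ring_nf
  -- Monotonicity of the sections holds only almost surely. A measurable exceptional set is fixed,
  -- and `A` is set to `{x}` there so that it is a random compact set for every `ω`.
  obtain ⟨N, hN, hNm, hN0⟩ := exists_measurable_superset_of_null (ae_iff.1 hanti)
  set G : Set Ω := Nᶜ
  have hGm : MeasurableSet G := hNm.compl
  have hGP : ∀ᵐ ω ∂P, ω ∈ G := by
    rw [ae_iff]; simpa [G] using hN0
  have hG : ∀ ω ∈ G, Antitone fun n => K n ω := fun ω hω => by
    by_contra hcon
    exact hω (hN hcon)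
  classical
  set A : Ω → Set E := fun ω => if ω ∈ G then ⋂ n, K n ω else {x} with hAd
  have hAG : ∀ ω ∈ G, A ω = ⋂ n, K n ω := fun ω hω => if_pos hω
  have hAnG : ∀ ω, ω ∉ G → A ω = {x} := fun ω hω => if_neg hω
  have hAne : ∀ ω, (A ω).Nonempty := fun ω => by
    by_cases hω : ω ∈ G
    · rw [hAG ω hω]
      exact IsCompact.nonempty_iInter_of_sequence_nonempty_isCompact_isClosed _
        (fun n => hG ω hω n.le_succ) (fun n => hKne n ω) (hKc 0 ω) fun n => (hKc n ω).isClosed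
    · rw [hAnG ω hω]
      exact singleton_nonempty x
  have hAc : ∀ ω, IsCompact (A ω) := fun ω => by
    by_cases hω : ω ∈ G
    · rw [hAG ω hω]
      exact (hKc 0 ω).of_isClosed_subset (isClosed_iInter fun n => (hKc n ω).isClosed)
        (iInter_subset _ 0)
    · rw [hAnG ω hω]
      exact isCompact_singleton
  have hAm : ∀ y, Measurable fun ω => Metric.infDist y (A ω) := fun y => by
    refine measurable_of_Iic fun c => ?_
    have key : (fun ω => Metric.infDist y (A ω)) ⁻¹' Iic c =
        (G ∩ ⋂ n, {ω | Metric.infDist y (K n ω) ≤ c}) ∪ (Gᶜ ∩ {_ω | dist y x ≤ c}) := by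
      ext ω
      by_cases hω : ω ∈ G
      · simp only [mem_preimage, mem_Iic, hAG ω hω, mem_union, mem_inter_iff, hω, mem_iInter,
          true_and, mem_compl_iff, not_true_eq_false, false_and, or_false]
        constructor
        · intro hle n
          refine (Metric.infDist_le_infDist_of_subset (iInter_subset _ n) ?_).trans hle
          rw [← hAG ω hω]
          exact hAne ω
        · intro hle
          obtain ⟨z, hz⟩ := IsCompact.nonempty_iInter_of_sequence_nonempty_isCompact_isClosed
            (fun n => K n ω ∩ Metric.closedBall y c)
            (fun n => inter_subset_inter_left _ (hG ω hω n.le_succ))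
            (fun n => by
              obtain ⟨z, hz, hzd⟩ := (hKc n ω).exists_infDist_eq_dist (hKne n ω) y
              have : Metric.infDist y (K n ω) ≤ c := hle n
              exact ⟨z, hz, Metric.mem_closedBall'.2 (hzd ▸ this)⟩)
            ((hKc 0 ω).inter_right Metric.isClosed_closedBall)
            fun n => (hKc n ω).isClosed.inter Metric.isClosed_closedBall
          rw [mem_iInter] at hz
          exact (Metric.infDist_le_dist_of_mem (mem_iInter.2 fun n => (hz n).1)).trans
            (Metric.mem_closedBall'.1 (hz 0).2)
      · simp only [mem_preimage, mem_Iic, hAnG ω hω, mem_union, mem_inter_iff, hω,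
          mem_compl_iff, not_false_eq_true, false_and, true_and, false_or,
          Metric.infDist_singleton]
        rfl
    rw [key]
    refine (hGm.inter (MeasurableSet.iInter fun n => measurableSet_le ?_ measurable_const)).union
      (hGm.compl.inter (MeasurableSet.const _))
    exact h.measurable_infDist_pullbackSection hb hbm n y
  have hinvτ : ∀ᵐ ω ∂P, φ τ ω '' A ω = A (θ τ ω) := by
    filter_upwards [hGP, h.base.ae_comp τ hGP] with ω h1 h2
    rw [hAG _ h1, hAG _ h2, image_iInter_of_antitone_of_isCompact (h.continuous τ ω) (hG ω h1)
      fun n => hKc n ω]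
    have e : ∀ n, φ τ ω '' K n ω = K (n + 1) (θ τ ω) := fun n => by
      rw [hKd, pullbackSection, pullbackSection, ← range_comp]
      congr 1
      ext d
      have e1 : θ (-(((n + 1 : ℕ) : ℝ) * τ)) (θ τ ω) = θ (-(n * τ)) ω := by
        rw [← h.base.map_add]
        push_cast
        ring_nf
      have e2 := h.cocycle (n * τ) τ (θ (-(n * τ)) ω) (b (θ (-(n * τ)) ω) d)
      rw [show ((n * τ : ℝ≥0) : ℝ) = n * τ by push_cast; rfl, h.base.comp_neg] at e2
      rw [e1, show (((n + 1 : ℕ) : ℝ≥0)) * τ = τ + n * τ by push_cast; ring, e2]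
      rfl
    simp only [e]
    exact subset_antisymm (fun y hy => mem_iInter.2 fun n =>
      hG _ h2 n.le_succ (mem_iInter.1 hy n)) fun y hy => mem_iInter.2 fun n => mem_iInter.1 hy _
  have hattr : ∀ B : Set E, IsCompact B → ∀ᵐ ω ∂P, Tendsto (fun t : ℝ≥0 => ⨆ y ∈ B,
      Metric.infEDist (φ t (θ (-(t : ℝ)) ω) y) (A ω)) atTop (𝓝 0) := fun B hB => by
    have h1 : ∀ᵐ ω ∂P, ∀ n : ℕ, ∀ᶠ t : ℝ≥0 in atTop, ∀ y ∈ B,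
        φ t (θ (-(t : ℝ)) (θ (-(n * τ)) ω)) y ∈ range (b (θ (-(n * τ)) ω)) :=
      ae_all_iff.2 fun n => h.base.ae_comp _ (habs B hB)
    filter_upwards [h1, hGP] with ω hω hωG
    rw [ENNReal.tendsto_nhds_zero]
    intro ε hε
    obtain ⟨δ, hδ0, hδ⟩ := ENNReal.lt_iff_exists_nnreal_btwn.1 hε
    have hδ0' : (0 : ℝ) < δ := by exact_mod_cast hδ0
    -- By compactness some single section already lies in the `δ`-neighbourhood of `A ω`; absorption
    -- at time `-nτ` brings all long trajectories into it.
    obtain ⟨n, hn⟩ := exists_subset_nhds_of_isCompact (hG ω hωG).directed_ge (fun n => hKc n ω)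
      (U := Metric.thickening δ (A ω)) (fun y hy => by
        rw [← hAG ω hωG] at hy
        exact Metric.isOpen_thickening.mem_nhds (Metric.self_subset_thickening hδ0' _ hy))
    obtain ⟨T, hT⟩ := eventually_atTop.1 (hω n)
    filter_upwards [eventually_ge_atTop (T + n * τ)] with t ht
    refine iSup₂_le fun y hy => ?_
    obtain ⟨t', rfl⟩ : ∃ t', t = n * τ + t' :=
      ⟨t - n * τ, (add_tsub_cancel_of_le (le_add_self.trans ht)).symm⟩
    have ht' : T ≤ t' := by
      rw [add_comm] at ht
      exact le_of_add_le_add_left ht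
    obtain ⟨d, hd⟩ := hT t' ht' y hy
    have e := h.cocycle t' (n * τ) (θ (-((n * τ + t' : ℝ≥0) : ℝ)) ω) y
    have e1 : θ (-((n * τ + t' : ℝ≥0) : ℝ)) ω = θ (-(t' : ℝ)) (θ (-(n * τ)) ω) := by
      rw [← h.base.map_add]
      push_cast
      ring_nf
    rw [e1, h.base.comp_neg, ← hd] at e
    rw [e1, e]
    have hmem : φ (n * τ) (θ (-(n * τ)) ω) (b (θ (-(n * τ)) ω) d) ∈ K n ω := ⟨d, rfl⟩
    have := (Metric.mem_thickening_iff_infEDist_lt.1 (hn hmem)).le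
    rw [ENNReal.ofReal_coe_nnreal] at this
    exact this.trans hδ.le
  have hattrτ : ∀ m : ℕ, ∀ᵐ ω ∂P, Tendsto (fun n : ℕ => ⨆ y ∈ Metric.closedBall x m,
      Metric.infEDist (φ (n * τ) (θ (-(n * τ)) ω) y) (A ω)) atTop (𝓝 0) := fun m => by
    filter_upwards [hattr _ (isCompact_closedBall x m)] with ω hω
    have ht : Tendsto (fun n : ℕ => (n : ℝ≥0) * τ) atTop atTop :=
      tendsto_natCast_atTop_atTop.atTop_mul_const hτ
    simpa [Function.comp_def] using hω.comp ht
  have hsub : ∀ t : ℝ≥0, ∀ᵐ ω ∂P, φ t ω '' A ω ⊆ A (θ t ω) := fun t => by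
    have hmθ : Measurable (θ (-t)) := (h.base.measurePreserving _).measurable
    -- The absorbing sets are forward invariant only in steps of `τ`. For other `t`, the
    -- push-forward of `A` by time `t` is again invariant at time `τ`, so recurrence places it
    -- inside `A`. The sets `S m` bound it measurably by testing the image of `K 0`, which contains
    -- `A`, on a dense sequence.
    have key := h.ae_subset_of_attracts (τ := τ) (A := A)
      (A' := fun ω => φ t (θ (-t) ω) '' A (θ (-t) ω))
      (S := fun m => {ω | θ (-t) ω ∈ G} ∩ ⋂ i : ℕ, {ω | dist (φ t (θ (-t) ω)
        (b (θ (-t) ω) (TopologicalSpace.denseSeq D i))) x ≤ m}) x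
      (fun ω => (hAc ω).isClosed) hattrτ ?_ ?_ ?_ ?_
    · filter_upwards [h.base.ae_comp t key] with ω hω
      rwa [h.base.neg_comp] at hω
    · filter_upwards [h.base.ae_comp (-t) hinvτ] with ω hω
      rw [h.base.comm (-t) τ, ← hω, image_image, image_image]
      refine image_congr fun y _ => ?_
      have e1 := h.cocycle t τ (θ (-t) ω) y
      have e2 := h.cocycle τ t (θ (-t) ω) y
      rw [h.base.comp_neg] at e1
      rw [← e1, add_comm, e2]
    · intro m
      refine (hmθ hGm).inter (MeasurableSet.iInter fun i => measurableSet_le ?_ measurable_const)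
      have h2 : Measurable fun ω => (t, θ (-t) ω,
          b (θ (-t) ω) (TopologicalSpace.denseSeq D i)) :=
        measurable_const.prodMk (hmθ.prodMk ((hbm _).comp hmθ))
      exact (h.measurable.comp h2).dist measurable_const
    · rintro m ω ⟨hω1, hω2⟩ _ ⟨y, hy, rfl⟩
      have hy0 : y ∈ K 0 (θ (-t) ω) := by
        rw [hAG _ hω1] at hy
        exact mem_iInter.1 hy 0
      obtain ⟨d, rfl⟩ := hy0
      simp only [Nat.cast_zero, zero_mul, neg_zero, h.base.map_zero, h.map_zero]
      have hcl : IsClosed {d | dist (φ t (θ (-t) ω) (b (θ (-t) ω) d)) x ≤ m} :=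
        isClosed_le (((h.continuous _ _).comp (hb _)).dist continuous_const) continuous_const
      exact closure_minimal (by
        rintro _ ⟨i, rfl⟩
        exact mem_iInter.1 hω2 i) hcl (TopologicalSpace.denseRange_denseSeq D d)
    · filter_upwards [h.base.ae_comp (-t) hGP] with ω hω
      have hc : Continuous fun d => dist (φ t (θ (-t) ω) (b (θ (-t) ω) d)) x :=
        ((h.continuous _ _).comp (hb _)).dist continuous_const
      obtain ⟨r, hr⟩ := (isCompact_range hc).bddAbove
      obtain ⟨m, hm⟩ := exists_nat_ge r
      exact ⟨m, hω, mem_iInter.2 fun i => (hr ⟨_, rfl⟩).trans hm⟩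
  refine ⟨A, ⟨hAne, hAc, hAm⟩, fun t => ?_, hattr⟩
  obtain ⟨n, hn⟩ : ∃ n : ℕ, t ≤ n * τ := by
    obtain ⟨n, hn⟩ := exists_nat_ge (t / τ)
    exact ⟨n, (div_le_iff₀ hτ).1 hn⟩
  -- The reverse inclusion completes `t` to a multiple of `τ`: `A (θ t ω)` is the time-`nτ` image of
  -- the fibre at `-s`, and its first `s` units stay in `A ω` by the inclusion already shown.
  obtain ⟨s, hs⟩ : ∃ s, (n : ℝ≥0) * τ = t + s := ⟨n * τ - t, (add_tsub_cancel_of_le hn).symm⟩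
  have hs' : (n : ℝ) * τ = t + s := by exact_mod_cast congrArg NNReal.toReal hs
  have h3 := h.base.ae_comp t (h.ae_image_natMul_eq hinvτ)
  filter_upwards [hsub t, h.base.ae_comp (-s) (hsub s), h3] with ω h1 h2 h3
  refine h1.antisymm ?_
  have h4 := h3 n
  have e1 : θ (-(n * τ)) (θ t ω) = θ (-s) ω := by
    rw [← h.base.map_add, hs']
    ring_nf
  rw [e1, hs] at h4
  rw [h.base.comp_neg] at h2
  rw [← h4]
  rintro _ ⟨y, hy, rfl⟩
  rw [h.cocycle, h.base.comp_neg]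
  exact mem_image_of_mem _ (h2 (mem_image_of_mem _ hy))

end Existence

end Attractor

/-! ### The random dynamical system generated by the Lorenz system -/

section LorenzRDS

open PathSpace

variable {σ β ρ γ lam : ℝ}

/-- The solution map of the random Lorenz system. -/
noncomputable def lorenzSolutionMap (σ β ρ γ : ℝ) (hlam : 0 < lam) (t : ℝ≥0) (ω : PathSpace)
    (v : EuclideanSpace ℝ (Fin 3)) : EuclideanSpace ℝ (Fin 3) :=
  lorenzFlow σ β ρ lam (ouPath γ hlam ω) v t

lemma isLorenzSolutionMap_lorenzSolutionMap (hσ : 0 < σ) (hβ : 0 < β) (hlam : 0 < lam) :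
    IsLorenzSolutionMap σ β ρ γ lam (lorenzSolutionMap σ β ρ γ hlam) := fun ω v => by
  refine ⟨lorenzFlow_zero hσ hβ _ _, fun t => ?_⟩
  exact (hasDerivWithinAt_lorenzFlow hσ hβ (ouPath γ hlam ω) v t.2).congr_of_mem
    (fun r hr => by rw [lorenzSolutionMap, Real.coe_toNNReal r hr]) t.2

lemma IsLorenzSolutionMap.eq_lorenzSolutionMap (hσ : 0 < σ) (hβ : 0 < β) (hlam : 0 < lam)
    {φ : ℝ≥0 → PathSpace → EuclideanSpace ℝ (Fin 3) → EuclideanSpace ℝ (Fin 3)}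
    (hφ : IsLorenzSolutionMap σ β ρ γ lam φ) : φ = lorenzSolutionMap σ β ρ γ hlam := by
  ext1 t; ext1 ω; ext1 v
  obtain ⟨h0, h⟩ := hφ ω v
  have := eq_lorenzFlow (ρ := ρ) (lam := lam) hσ hβ (ouPath γ hlam ω)
    (u := fun r => φ r.toNNReal ω v) (fun r hr => by
      have := h ⟨r, hr⟩
      rw [show (⟨r, hr⟩ : ℝ≥0) = r.toNNReal from (Real.toNNReal_of_nonneg hr).symm,
        Real.coe_toNNReal r hr] at this
      exact this) t.2
  simpa [h0, lorenzSolutionMap] using this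

lemma lorenzSolutionMap_add (hσ : 0 < σ) (hβ : 0 < β) (hlam : 0 < lam) (s t : ℝ≥0) (ω : PathSpace)
    (v : EuclideanSpace ℝ (Fin 3)) :
    lorenzSolutionMap σ β ρ γ hlam (t + s) ω v =
      lorenzSolutionMap σ β ρ γ hlam t (shift s ω) (lorenzSolutionMap σ β ρ γ hlam s ω v) := by
  rw [lorenzSolutionMap, NNReal.coe_add]
  exact lorenzFlow_add hσ hβ s.2 (fun r => ouPath_shift hlam ω s r) v t.2

lemma isRDS_lorenzSolutionMap {P : Measure PathSpace} (hP : IsWienerMeasure P) (hσ : 0 < σ)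
    (hβ : 0 < β) (hlam : 0 < lam) : IsRDS P shift (lorenzSolutionMap σ β ρ γ hlam) where
  base := hP.isMetricDynamicalSystem
  measurable := by
    let _ : MeasurableSpace C(ℝ, ℝ) := borel _
    have : BorelSpace C(ℝ, ℝ) := ⟨rfl⟩
    have h1 : Measurable fun p : ℝ≥0 × PathSpace × EuclideanSpace ℝ (Fin 3) =>
        (ouPath γ hlam p.2.1, p.1, p.2.2) :=
      ((measurable_ouPath hlam).comp measurable_snd.fst).prodMk
        (measurable_fst.prodMk measurable_snd.snd)
    exact (continuous_lorenzFlow (ρ := ρ) (lam := lam) hσ hβ).measurable.comp h1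
  map_zero ω v := lorenzFlow_zero hσ hβ _ _
  cocycle s t ω v := lorenzSolutionMap_add hσ hβ hlam s t ω v
  continuous t ω := (continuous_lorenzFlow (ρ := ρ) (lam := lam) hσ hβ).comp
    (continuous_const.prodMk (continuous_const.prodMk continuous_id))

/-! ### The absorbing random ball -/

lemma add_mul_le_exp (p q x : ℝ) : p + q * x ≤ Real.exp (p + q * x) :=
  (by linarith : p + q * x ≤ p + q * x + 1).trans (Real.add_one_le_exp _)

/-- Energy estimate over `[0, h]` in the coordinates of the original stochastic system, where the
noise enters through its increments only. -/
lemma exists_cell_energy_le {κ : ℝ} (hκ : 0 < κ) (hκσ : κ ≤ σ) (hκ1 : κ ≤ 1) (hκβ : κ ≤ β)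
    (hlam : 0 < lam) (ρ γ : ℝ) {h : ℝ} (hh : 0 < h) :
    ∃ C₀ C₁ : ℝ, ∀ (ω : PathSpace) (u : ℝ → EuclideanSpace ℝ (Fin 3)), OUIntegrable lam ω →
      IsLorenzTrajectory σ β ρ lam (ouPath γ hlam ω) h u →
      lorenzEnergy (σ + ρ - ouVar γ lam (shift h ω)) (u h) ≤
        Real.exp (-(κ * h / 4) + noiseCellEnergy γ h ω / (2 * κ)) *
          lorenzEnergy (σ + ρ - ouVar γ lam ω) (u 0)
        + (Real.exp (C₀ + C₁ * (noiseCellEnergy γ h ω + (γ * ω h) ^ 2)) - 1) := by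
  set p := 2 * β ^ 2 * (σ + ρ) ^ 2 * h / κ + 1 with hp
  set q := 2 * β ^ 2 / κ + (1 + 4 / (κ * h)) with hq
  have hp0 : 1 ≤ p := by
    have : 0 ≤ 2 * β ^ 2 * (σ + ρ) ^ 2 * h / κ := by positivity
    linarith
  have hq0 : 0 ≤ q := by positivity
  refine ⟨κ * h / 4 + p, 1 / (2 * κ) + q, fun ω u hω hu => ?_⟩
  set Y := noiseCellEnergy γ h ω with hY
  set J := (γ * ω h) ^ 2 with hJ
  have hY0 : 0 ≤ Y := noiseCellEnergy_nonneg hh.le ω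
  have hJ0 : 0 ≤ J := sq_nonneg _
  set Q := ouDrift γ lam ω
  set e : EuclideanSpace ℝ (Fin 3) := !₂[0, 0, 1] with he
  have he0 : e 0 = 0 := rfl
  have he1 : e 1 = 0 := rfl
  have he2 : e 2 = 1 := rfl
  -- Since `Q' = -lam * O` and `O = γω + Q`, adding `Q` to the third coordinate turns the driver
  -- into `γω` and the coefficient `β - lam` into `β`.
  have hζ : IsLorenzTrajectory σ β ρ 0 (fun s => γ * ω s) h (fun t => u t + Q t • e) := by
    intro t ht
    have h1 := (hu t ht).add ((hasDerivAt_ouDrift (γ := γ) hlam hω t).hasDerivWithinAt.smul_const e)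
    refine h1.congr_deriv ?_
    rw [ouPath_apply, ouVar_shift hlam hω]
    ext i
    fin_cases i <;> simp [lorenzField, he, Q] <;> ring
  have hωc := ω.continuous_apply
  have h1 := hζ.energy_le hκ hκσ hκ1 hκβ (by fun_prop) hh.le
  have hYi : ∫ s in (0)..h, (γ * ω s) ^ 2 / (2 * κ) = Y / (2 * κ) := by
    rw [intervalIntegral.integral_div, hY, noiseCellEnergy]
  have hFi : ∫ s in (0)..h, energyForcing σ β ρ 0 κ (γ * ω s) =
      (2 * β ^ 2 * (σ + ρ) ^ 2 * h + 2 * β ^ 2 * Y) / κ := by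
    simp only [energyForcing, sub_zero]
    rw [intervalIntegral.integral_div, intervalIntegral.integral_add (by simp)
      ((by fun_prop : Continuous fun s => 2 * β ^ 2 * (γ * ω s) ^ 2).intervalIntegrable _ _),
      intervalIntegral.integral_const_mul, hY, noiseCellEnergy]
    simp
    ring
  rw [hYi, hFi] at h1
  have hQ0 : Q 0 = ouVar γ lam ω := by
    have := ouVar_shift (γ := γ) hlam hω 0
    rw [shift_zero, apply_zero, mul_zero, zero_add] at this
    exact this.symm
  have e0 : lorenzEnergy (σ + ρ) (u 0 + Q 0 • e) =
      lorenzEnergy (σ + ρ - ouVar γ lam ω) (u 0) := by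
    simp only [lorenzEnergy, PiLp.add_apply, PiLp.smul_apply, he0, he1, he2, smul_eq_mul, hQ0]
    ring
  have hε : 0 < κ * h / 4 := by positivity
  -- Recentring by the increment `γ * ω h` uses Young's inequality with weight `κh/4`. The resulting
  -- factor `1 + κh/4 ≤ exp (κh/4)` consumes half of the decay `exp (-κh/2)`.
  have eh : lorenzEnergy (σ + ρ - ouVar γ lam (shift h ω)) (u h) ≤
      (1 + κ * h / 4) * lorenzEnergy (σ + ρ) (u h + Q h • e) + (1 + 4 / (κ * h)) * J := by
    rw [ouVar_shift hlam hω]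
    simp only [lorenzEnergy, PiLp.add_apply, PiLp.smul_apply, he0, he1, he2, smul_eq_mul, hJ]
    set w := u h 2 + Q h * 1 - (σ + ρ) with hw
    set g := γ * ω h
    have e1 : u h 2 - (σ + ρ - (g + ouDrift γ lam ω h)) = w + g := by rw [hw]; ring
    rw [e1]
    have e2 : 2 * w * g ≤ κ * h / 4 * w ^ 2 + 4 / (κ * h) * g ^ 2 := by
      have e3 : 4 / (κ * h) = 1 / (κ * h / 4) := by field_simp
      rw [e3]
      set ε := κ * h / 4
      have e4 : ε * w ^ 2 + 1 / ε * g ^ 2 - 2 * w * g = (ε * w - g) ^ 2 / ε := by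
        field_simp; ring
      have e5 : 0 ≤ (ε * w - g) ^ 2 / ε := by positivity
      linarith
    have e6 : 0 ≤ κ * h / 4 * u h 0 ^ 2 := by positivity
    have e7 : 0 ≤ κ * h / 4 * u h 1 ^ 2 := by positivity
    simp only [mul_zero, add_zero]
    have e8 : (1 + κ * h / 4) * (u h 0 ^ 2 + u h 1 ^ 2 + w ^ 2) + (1 + 4 / (κ * h)) * g ^ 2 -
        (u h 0 ^ 2 + u h 1 ^ 2 + (w + g) ^ 2) = κ * h / 4 * u h 0 ^ 2 + κ * h / 4 * u h 1 ^ 2 +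
        (κ * h / 4 * w ^ 2 + 4 / (κ * h) * g ^ 2 - 2 * w * g) := by ring
    linarith
  rw [e0] at h1
  have hE0 := lorenzEnergy_nonneg (σ + ρ - ouVar γ lam ω) (u 0)
  set W := lorenzEnergy (σ + ρ - ouVar γ lam ω) (u 0)
  set F := (2 * β ^ 2 * (σ + ρ) ^ 2 * h + 2 * β ^ 2 * Y) / κ with hF
  have hF0 : 0 ≤ F := by positivity
  have hexp : 1 + κ * h / 4 ≤ Real.exp (κ * h / 4) := by
    linarith [Real.add_one_le_exp (κ * h / 4)]
  have h2 : (1 + κ * h / 4) * lorenzEnergy (σ + ρ) (u h + Q h • e) ≤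
      Real.exp (κ * h / 4) * (Real.exp (-(κ / 2) * h + Y / (2 * κ)) * W
        + Real.exp (Y / (2 * κ)) * F) :=
    mul_le_mul hexp h1 (lorenzEnergy_nonneg _ _) (Real.exp_pos _).le
  have h3 : Real.exp (κ * h / 4) * (Real.exp (-(κ / 2) * h + Y / (2 * κ)) * W) =
      Real.exp (-(κ * h / 4) + Y / (2 * κ)) * W := by
    rw [← mul_assoc, ← Real.exp_add]
    congr 2
    ring
  set H := Y + J with hH
  -- The additive error, together with an extra `1`, is put under one exponential whose exponent is
  -- affine in an integrable quantity, so no exponential moments are needed. The extra `1` is the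
  -- slack used for absorption.
  have h4 : Real.exp (κ * h / 4) * (Real.exp (Y / (2 * κ)) * F) + (1 + 4 / (κ * h)) * J + 1 ≤
      Real.exp (κ * h / 4 + p + (1 / (2 * κ) + q) * H) := by
    have e1 : Real.exp (κ * h / 4) * Real.exp (Y / (2 * κ)) ≤
        Real.exp (κ * h / 4 + 1 / (2 * κ) * H) := by
      rw [← Real.exp_add, Real.exp_le_exp, div_eq_mul_one_div Y, mul_comm Y]
      gcongr
      linarith
    have e2 : 1 ≤ Real.exp (κ * h / 4 + 1 / (2 * κ) * H) := Real.one_le_exp (by positivity)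
    set A := Real.exp (κ * h / 4 + 1 / (2 * κ) * H)
    have e3 : F + ((1 + 4 / (κ * h)) * J + 1) ≤ p + q * H := by
      have : F = 2 * β ^ 2 * (σ + ρ) ^ 2 * h / κ + 2 * β ^ 2 / κ * Y := by rw [hF]; ring
      rw [this, hp, hq, hH]
      have : 0 ≤ 2 * β ^ 2 / κ * J := by positivity
      have : 0 ≤ (1 + 4 / (κ * h)) * Y := by positivity
      have e : 2 * β ^ 2 * (σ + ρ) ^ 2 * h / κ + 1
          + (2 * β ^ 2 / κ + (1 + 4 / (κ * h))) * (Y + J)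
          - (2 * β ^ 2 * (σ + ρ) ^ 2 * h / κ + 2 * β ^ 2 / κ * Y + ((1 + 4 / (κ * h)) * J + 1)) =
          2 * β ^ 2 / κ * J + (1 + 4 / (κ * h)) * Y := by ring
      linarith
    have e4 : 0 ≤ (1 + 4 / (κ * h)) * J + 1 := by positivity
    calc Real.exp (κ * h / 4) * (Real.exp (Y / (2 * κ)) * F) + (1 + 4 / (κ * h)) * J + 1
        = Real.exp (κ * h / 4) * Real.exp (Y / (2 * κ)) * F + 1 * ((1 + 4 / (κ * h)) * J + 1) := by
          ring
      _ ≤ A * F + A * ((1 + 4 / (κ * h)) * J + 1) :=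
          add_le_add (mul_le_mul_of_nonneg_right e1 hF0) (mul_le_mul_of_nonneg_right e2 e4)
      _ = A * (F + ((1 + 4 / (κ * h)) * J + 1)) := by ring
      _ ≤ A * Real.exp (p + q * H) :=
          mul_le_mul_of_nonneg_left (e3.trans (add_mul_le_exp p q H)) (Real.exp_pos _).le
      _ = _ := by
          rw [← Real.exp_add]
          congr 1
          ring
  linarith

/-- A crude energy estimate over a part of an interval of length `h`. -/
lemma exists_partial_cell_energy_le {κ : ℝ} (hκ : 0 < κ) (hκσ : κ ≤ σ) (hκ1 : κ ≤ 1) (hκβ : κ ≤ β)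
    (ρ lam h m : ℝ) :
    ∃ D₀ D₁ : ℝ, ∀ (o : ℝ → ℝ) (u : ℝ → EuclideanSpace ℝ (Fin 3)) (s X : ℝ), Continuous o →
      s ∈ Icc 0 h → IsLorenzTrajectory σ β ρ lam o s u → ‖u 0‖ ≤ m → ∫ r in (0)..s, o r ^ 2 ≤ X →
      lorenzEnergy (σ + ρ - o s) (u s) ≤ Real.exp (D₀ + D₁ * (X + o s ^ 2)) := by
  set p := 2 * (2 * m ^ 2 + 2 * (σ + ρ) ^ 2 + 2 * β ^ 2 * (σ + ρ) ^ 2 * |h| / κ) with hp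
  set q := 2 * (2 * (β - lam) ^ 2 / κ) + 2 with hq
  have hp0 : 0 ≤ p := by positivity
  have hq0 : 0 ≤ q := by positivity
  refine ⟨p, 1 / (2 * κ) + q, fun o u s X ho hs hu hu0 hX => ?_⟩
  have h1 := hu.energy_le hκ hκσ hκ1 hκβ ho hs.1
  have hX0 : 0 ≤ ∫ r in (0)..s, o r ^ 2 := intervalIntegral.integral_nonneg hs.1 fun _ _ => sq_nonneg _
  rw [intervalIntegral.integral_div] at h1
  set Z := ∫ r in (0)..s, o r ^ 2
  have hFi : ∫ r in (0)..s, energyForcing σ β ρ lam κ (o r) ≤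
      (2 * β ^ 2 * (σ + ρ) ^ 2 * |h| + 2 * (β - lam) ^ 2 * X) / κ := by
    simp only [energyForcing]
    rw [intervalIntegral.integral_div, intervalIntegral.integral_add (by simp)
      ((by fun_prop : Continuous fun s => 2 * (β - lam) ^ 2 * (o s) ^ 2).intervalIntegrable _ _),
      intervalIntegral.integral_const_mul (2 * (β - lam) ^ 2), intervalIntegral.integral_const,
      smul_eq_mul, sub_zero, mul_comm s]
    have : s ≤ |h| := hs.2.trans (le_abs_self h)
    exact div_le_div_of_nonneg_right (add_le_add (mul_le_mul_of_nonneg_left this (by positivity))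
      (mul_le_mul_of_nonneg_left hX (by positivity))) hκ.le
  have hE0 := lorenzEnergy_nonneg (σ + ρ) (u 0)
  have hE0' : lorenzEnergy (σ + ρ) (u 0) ≤ 2 * m ^ 2 + 2 * (σ + ρ) ^ 2 := by
    refine (lorenzEnergy_le _ _).trans ?_
    gcongr
  have hF0 : 0 ≤ ∫ r in (0)..s, energyForcing σ β ρ lam κ (o r) :=
    intervalIntegral.integral_nonneg hs.1 fun _ _ => energyForcing_nonneg hκ _
  have hA1 : Real.exp (-(κ / 2) * s + Z / (2 * κ)) ≤ Real.exp (X / (2 * κ)) := by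
    apply Real.exp_le_exp.2
    have : Z / (2 * κ) ≤ X / (2 * κ) := by gcongr
    nlinarith [mul_nonneg hκ.le hs.1]
  have hA2 : Real.exp (Z / (2 * κ)) ≤ Real.exp (X / (2 * κ)) := by
    apply Real.exp_le_exp.2
    gcongr
  have hXn : 0 ≤ X := hX0.trans hX
  have h2 := mul_le_mul hA1 hE0' hE0 (Real.exp_pos _).le
  have h3 := mul_le_mul hA2 hFi hF0 (Real.exp_pos _).le
  set O := o s ^ 2 with hO
  have hO0 : 0 ≤ O := sq_nonneg _
  -- Recentring here may cost a factor `2`, since this estimate is used only once per trajectory.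
  have h4 : lorenzEnergy (σ + ρ - o s) (u s) ≤ 2 * lorenzEnergy (σ + ρ) (u s) + 2 * O := by
    simp only [lorenzEnergy, hO]
    nlinarith [sq_nonneg (u s 0), sq_nonneg (u s 1), sq_nonneg (u s 2 - (σ + ρ) - o s)]
  set F := (2 * β ^ 2 * (σ + ρ) ^ 2 * |h| + 2 * (β - lam) ^ 2 * X) / κ with hF
  have e1 : Real.exp (X / (2 * κ)) ≤ Real.exp (1 / (2 * κ) * (X + O)) := by
    rw [Real.exp_le_exp, div_eq_mul_one_div X, mul_comm X]
    gcongr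
    linarith
  have e2 : 1 ≤ Real.exp (1 / (2 * κ) * (X + O)) := Real.one_le_exp (by positivity)
  set A := Real.exp (1 / (2 * κ) * (X + O))
  have e3 : 2 * (2 * m ^ 2 + 2 * (σ + ρ) ^ 2 + F) + 2 * O ≤ p + q * (X + O) := by
    have : F = 2 * β ^ 2 * (σ + ρ) ^ 2 * |h| / κ + 2 * (β - lam) ^ 2 / κ * X := by rw [hF]; ring
    rw [this, hp, hq]
    have : 0 ≤ 2 * (β - lam) ^ 2 / κ * O := by positivity
    rw [add_mul, mul_add (2 * (2 * (β - lam) ^ 2 / κ))]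
    linarith
  have hF1 : 0 ≤ 2 * m ^ 2 + 2 * (σ + ρ) ^ 2 + F := by positivity
  calc lorenzEnergy (σ + ρ - o s) (u s)
      ≤ Real.exp (X / (2 * κ)) * (2 * (2 * m ^ 2 + 2 * (σ + ρ) ^ 2 + F)) + 1 * (2 * O) := by
        linarith
    _ ≤ A * (2 * (2 * m ^ 2 + 2 * (σ + ρ) ^ 2 + F)) + A * (2 * O) :=
        add_le_add (mul_le_mul_of_nonneg_right e1 (by positivity))
          (mul_le_mul_of_nonneg_right e2 (by positivity))
    _ = A * (2 * (2 * m ^ 2 + 2 * (σ + ρ) ^ 2 + F) + 2 * O) := by ring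
    _ ≤ A * Real.exp (p + q * (X + O)) :=
        mul_le_mul_of_nonneg_left (e3.trans (add_mul_le_exp p q _)) (Real.exp_pos _).le
    _ = _ := by
        rw [← Real.exp_add]
        congr 1
        ring

/-- Eventually `s n ≤ (l/2) n`, so a geometric series dominates. -/
lemma summable_exp_of_tendsto_div {s : ℕ → ℝ} {l : ℝ} (hl : l < 0)
    (hs : Tendsto (fun n : ℕ => s n / n) atTop (𝓝 l)) : Summable fun n => Real.exp (s n) := by
  have hl2 : l < l / 2 := by linarith
  have hgeo : Summable fun n : ℕ => Real.exp (l / 2) ^ n :=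
    summable_geometric_of_lt_one (Real.exp_pos _).le (Real.exp_lt_one_iff.2 (by linarith))
  refine summable_of_isBigO_nat hgeo (Asymptotics.IsBigO.of_bound 1 ?_)
  filter_upwards [hs.eventually (gt_mem_nhds hl2), eventually_gt_atTop 0] with n hn hn0
  have hn0' : (0 : ℝ) < n := by exact_mod_cast hn0
  rw [div_lt_iff₀ hn0'] at hn
  rw [one_mul, Real.norm_eq_abs, Real.norm_eq_abs, Real.abs_exp, ← Real.exp_nat_mul, Real.abs_exp,
    Real.exp_le_exp]
  linarith

end LorenzRDS

/-! ### The stationary radius, pullback absorption, and the attractor of the Lorenz system. -/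

section AbsorbingBall

open PathSpace

/-- The solution at time `0`, started at time `-n`, of the affine recursion
`r_{k+1} = exp (a_k) r_k + exp (g_k)`. -/
noncomputable def recursionTerm (h : ℝ) (a g : PathSpace → ℝ) (n : ℕ) (ω : PathSpace) : ℝ :=
  (∑ i ∈ Finset.range n, a (shift (-((i + 1) * h)) ω)) + g (shift (-((n + 1) * h)) ω)

/-- The stationary solution of the affine recursion `r_{k+1} = exp (a_k) r_k + exp (g_k)`. -/
noncomputable def stationaryRadius (h : ℝ) (a g : PathSpace → ℝ) (ω : PathSpace) : ℝ :=
  ∑' n, Real.exp (recursionTerm h a g n ω)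

variable {h : ℝ} {a g : PathSpace → ℝ}

lemma measurable_recursionTerm (ha : Measurable a) (hg : Measurable g) (n : ℕ) :
    Measurable (recursionTerm h a g n) :=
  (Finset.measurable_fun_sum _ fun _ _ => ha.comp (measurable_shift_apply _)).add
    (hg.comp (measurable_shift_apply _))

lemma measurable_stationaryRadius (ha : Measurable a) (hg : Measurable g) :
    Measurable (stationaryRadius h a g) :=
  Measurable.tsum fun n => (measurable_recursionTerm ha hg n).exp

lemma stationaryRadius_nonneg (ω : PathSpace) : 0 ≤ stationaryRadius h a g ω :=
  tsum_nonneg fun _ => (Real.exp_pos _).le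

lemma recursionTerm_zero_shift (ω : PathSpace) : recursionTerm h a g 0 (shift h ω) = g ω := by
  rw [recursionTerm, ← shift_add]
  simp [shift_zero]

lemma recursionTerm_succ_shift (n : ℕ) (ω : PathSpace) :
    recursionTerm h a g (n + 1) (shift h ω) = a ω + recursionTerm h a g n ω := by
  rw [recursionTerm, recursionTerm, Finset.sum_range_succ']
  simp only [← shift_add]
  have e : ∀ x : ℝ, -((x + 1 + 1) * h) + h = -((x + 1) * h) := fun x => by ring
  push_cast
  simp only [e]
  simp [shift_zero]
  ring

/-- Shifting by one cell multiplies every old term by `exp (a ω)` and inserts the newest forcing as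
term zero. -/
lemma stationaryRadius_shift {ω : PathSpace}
    (hs : Summable fun n => Real.exp (recursionTerm h a g n ω)) :
    stationaryRadius h a g (shift h ω) =
      Real.exp (a ω) * stationaryRadius h a g ω + Real.exp (g ω) := by
  have e : ∀ n, Real.exp (recursionTerm h a g (n + 1) (shift h ω)) =
      Real.exp (a ω) * Real.exp (recursionTerm h a g n ω) := fun n => by
    rw [recursionTerm_succ_shift, Real.exp_add]
  have hs' : Summable fun n => Real.exp (recursionTerm h a g n (shift h ω)) := by
    rw [← summable_nat_add_iff 1]
    simp only [e]
    exact hs.mul_left _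
  rw [stationaryRadius, hs'.tsum_eq_zero_add, recursionTerm_zero_shift]
  simp only [e]
  rw [tsum_mul_left, add_comm]
  rfl

/-- The exponents of the recursion grow linearly with negative slope. -/
lemma tendsto_recursionTerm_div {ω : PathSpace} {l : ℝ}
    (ha : Tendsto (fun n : ℕ => (∑ i ∈ Finset.range n, a (shift (-((i + 1) * h)) ω)) / n) atTop (𝓝 l))
    (hg : Tendsto (fun n : ℕ => g (shift (-((n + 1) * h)) ω) / n) atTop (𝓝 0)) :
    Tendsto (fun n : ℕ => recursionTerm h a g n ω / n) atTop (𝓝 l) := by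
  have := ha.add hg
  rw [add_zero] at this
  simpa only [recursionTerm, add_div] using this

lemma tendsto_const_add_mul_div {x : ℕ → ℝ} (c d : ℝ)
    (hx : Tendsto (fun n : ℕ => x n / n) atTop (𝓝 0)) :
    Tendsto (fun n : ℕ => (c + d * x n) / n) atTop (𝓝 0) := by
  have := (tendsto_const_div_atTop_nhds_zero_nat c).add (hx.const_mul d)
  rw [mul_zero, add_zero] at this
  refine this.congr fun n => ?_
  ring

/-- Iterating the one-step estimate `V (θ_h ω) (φ_h ω v) ≤ exp (a ω) V ω v + (exp (g ω) - 1)`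
along the past of `ω`. -/
lemma IsRDS.le_of_step_le {E : Type*} [TopologicalSpace E] [MeasurableSpace E]
    {P : Measure PathSpace} {φ : ℝ≥0 → PathSpace → E → E} (hφ : IsRDS P shift φ) {τ : ℝ≥0}
    {V : PathSpace → E → ℝ} {ω : PathSpace}
    (hstep : ∀ (n : ℕ) (v : E), V (shift (-(n * τ)) ω) (φ τ (shift (-((n + 1) * τ)) ω) v) ≤
      Real.exp (a (shift (-((n + 1) * τ)) ω)) * V (shift (-((n + 1) * τ)) ω) v
        + (Real.exp (g (shift (-((n + 1) * τ)) ω)) - 1)) (n : ℕ) (v : E) :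
    V ω (φ (n * τ) (shift (-(n * τ)) ω) v) ≤
      Real.exp (∑ i ∈ Finset.range n, a (shift (-((i + 1) * τ)) ω)) * V (shift (-(n * τ)) ω) v
        + ∑ j ∈ Finset.range n, (Real.exp (recursionTerm τ a g j ω)
          - Real.exp (∑ i ∈ Finset.range j, a (shift (-((i + 1) * τ)) ω))) := by
  induction n generalizing v with
  | zero => simp [hφ.base.map_zero, hφ.map_zero]
  | succ n ih =>
    have e := hφ.cocycle τ (n * τ) (shift (-((n + 1) * τ)) ω) v
    rw [← hφ.base.map_add] at e
    have e1 : ((τ : ℝ) + -((n + 1) * τ)) = -(n * τ) := by ring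
    rw [e1] at e
    have e2 : (((n + 1 : ℕ) : ℝ≥0)) * τ = n * τ + τ := by push_cast; ring
    rw [e2]
    push_cast
    rw [e, Finset.sum_range_succ, Finset.sum_range_succ, Real.exp_add]
    -- The oldest step is peeled off: the induction hypothesis applies to the state reached at time
    -- `-nτ`.
    have h1 := ih (φ τ (shift (-((n + 1) * τ)) ω) v)
    have h2 := mul_le_mul_of_nonneg_left (hstep n v)
      (Real.exp_pos (∑ i ∈ Finset.range n, a (shift (-((i + 1) * τ)) ω))).le
    have h3 : Real.exp (recursionTerm τ a g n ω) =
        Real.exp (∑ i ∈ Finset.range n, a (shift (-((i + 1) * τ)) ω)) *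
          Real.exp (g (shift (-((n + 1) * τ)) ω)) := by
      rw [recursionTerm, Real.exp_add]
    rw [h3]
    linarith

variable {σ β ρ γ lam : ℝ}

/-- A parametrization of the ball `{v | lorenzEnergy (c - O ω) v ≤ r ω}` by the unit ball. -/
noncomputable def randomBall (γ lam c : ℝ) (r : PathSpace → ℝ) (ω : PathSpace)
    (d : Metric.closedBall (0 : EuclideanSpace ℝ (Fin 3)) 1) : EuclideanSpace ℝ (Fin 3) :=
  !₂[0, 0, c - ouVar γ lam ω] + √(r ω) • (d : EuclideanSpace ℝ (Fin 3))

lemma continuous_randomBall {c : ℝ} {r : PathSpace → ℝ} (ω : PathSpace) :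
    Continuous (randomBall γ lam c r ω) := by
  unfold randomBall
  fun_prop

lemma measurable_randomBall {c : ℝ} {r : PathSpace → ℝ} (hr : Measurable r)
    (d : Metric.closedBall (0 : EuclideanSpace ℝ (Fin 3)) 1) :
    Measurable fun ω => randomBall γ lam c r ω d := by
  unfold randomBall
  have h1 : Continuous fun x : ℝ => (!₂[0, 0, c - x] : EuclideanSpace ℝ (Fin 3)) := by
    refine (PiLp.continuous_toLp 2 _).comp (continuous_pi fun i => ?_)
    fin_cases i <;> simp <;> fun_prop
  exact (h1.measurable.comp measurable_ouVar).add (hr.sqrt.smul_const _)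

lemma mem_range_randomBall {c : ℝ} {r : PathSpace → ℝ} {ω : PathSpace} (hr : 0 ≤ r ω)
    {v : EuclideanSpace ℝ (Fin 3)} :
    v ∈ range (randomBall γ lam c r ω) ↔ lorenzEnergy (c - ouVar γ lam ω) v ≤ r ω := by
  rw [lorenzEnergy_eq]
  constructor
  · rintro ⟨⟨d, hd⟩, rfl⟩
    rw [mem_closedBall_zero_iff] at hd
    rw [randomBall, add_sub_cancel_left, norm_smul, mul_pow, Real.norm_eq_abs, sq_abs,
      Real.sq_sqrt hr]
    exact mul_le_of_le_one_right hr (pow_le_one₀ (norm_nonneg _) hd)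
  · intro hv
    have hv' : ‖v - !₂[0, 0, c - ouVar γ lam ω]‖ ≤ √(r ω) := Real.le_sqrt_of_sq_le hv
    set w := v - !₂[0, 0, c - ouVar γ lam ω] with hw
    have hvw : v = !₂[0, 0, c - ouVar γ lam ω] + w := by rw [hw]; abel
    rcases eq_or_lt_of_le (Real.sqrt_nonneg (r ω)) with h0 | h0
    · rw [← h0] at hv'
      refine ⟨⟨0, by simp⟩, ?_⟩
      rw [hvw, norm_le_zero_iff.1 hv', randomBall]
      simp
    · refine ⟨⟨(√(r ω))⁻¹ • w, ?_⟩, ?_⟩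
      · rw [mem_closedBall_zero_iff, norm_smul, norm_inv, Real.norm_eq_abs,
          abs_of_pos h0, inv_mul_le_iff₀ h0, mul_one]
        exact hv'
      · rw [hvw, randomBall]
        simp only
        rw [smul_smul, mul_inv_cancel₀ h0.ne', one_smul]

/-- The energy over the final part of a cell is bounded by that of the whole cell, which gives a
bound independent of `s`. -/
lemma integral_sq_comp_add_le {f : ℝ → ℝ} (hf : Continuous f) {s h : ℝ} (hs : s ∈ Icc 0 h) :
    ∫ r in (0)..s, f (r + (h - s)) ^ 2 ≤ ∫ r in (0)..h, f r ^ 2 := by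
  rw [intervalIntegral.integral_comp_add_right (fun r => f r ^ 2) (h - s), zero_add,
    add_sub_cancel]
  rw [← intervalIntegral.integral_add_adjacent_intervals
    ((by fun_prop : Continuous fun r => f r ^ 2).intervalIntegrable 0 (h - s))
    ((by fun_prop : Continuous fun r => f r ^ 2).intervalIntegrable (h - s) h)]
  have : 0 ≤ ∫ r in (0)..(h - s), f r ^ 2 :=
    intervalIntegral.integral_nonneg (sub_nonneg.2 hs.2) fun _ _ => sq_nonneg _
  linarith

theorem exists_isPullbackAttractor_lorenzSolutionMap {P : Measure PathSpace}
    (hP : IsWienerMeasure P) (hσ : 0 < σ) (hβ : 0 < β) (hlam : 0 < lam) :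
    ∃ A : PathSpace → Set (EuclideanSpace ℝ (Fin 3)),
      IsPullbackAttractor P shift (lorenzSolutionMap σ β ρ γ hlam) A := by
  have hRDS := isRDS_lorenzSolutionMap (ρ := ρ) (γ := γ) hP hσ hβ hlam
  have hbase := hRDS.base
  have := hP.isProbabilityMeasure
  set φ := lorenzSolutionMap σ β ρ γ hlam with hφ
  set κ := min σ (min 1 β) with hκd
  have hκ : 0 < κ := by positivity
  have hκσ : κ ≤ σ := min_le_left _ _
  have hκ1 : κ ≤ 1 := (min_le_right _ _).trans (min_le_left _ _)
  have hκβ : κ ≤ β := (min_le_right _ _).trans (min_le_right _ _)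
  -- With this cell length the mean noise contribution `γ²τ²/(4κ)` is at most `κτ/8`, half of the
  -- remaining decay `κτ/4`; hence `E a < 0`.
  obtain ⟨τ, hτ, hτγ⟩ : ∃ τ : ℝ≥0, 0 < τ ∧ γ ^ 2 * τ ≤ κ ^ 2 / 2 := by
    refine ⟨⟨κ ^ 2 / (2 * (γ ^ 2 + 1)), by positivity⟩,
      (by positivity : 0 < κ ^ 2 / (2 * (γ ^ 2 + 1))), ?_⟩
    show γ ^ 2 * (κ ^ 2 / (2 * (γ ^ 2 + 1))) ≤ κ ^ 2 / 2
    rw [← mul_div_assoc, div_le_div_iff₀ (by positivity) (by norm_num)]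
    nlinarith [sq_nonneg κ, sq_nonneg γ]
  have hτ' : (0 : ℝ) < τ := by exact_mod_cast hτ
  obtain ⟨C₀, C₁, hcell⟩ := exists_cell_energy_le hκ hκσ hκ1 hκβ hlam ρ γ hτ'
  set a : PathSpace → ℝ := fun ω => -(κ * τ / 4) + noiseCellEnergy γ τ ω / (2 * κ) with ha
  set H : PathSpace → ℝ := fun ω => noiseCellEnergy γ τ ω + (γ * ω τ) ^ 2 with hH
  set g : PathSpace → ℝ := fun ω => C₀ + C₁ * H ω with hg
  set H' : PathSpace → ℝ := fun ω => ouCellEnergy γ lam τ ω + ouVar γ lam (shift τ ω) ^ 2 with hH'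
  have hHm : Measurable H := (measurable_noiseCellEnergy hτ'.le).add
    (((measurable_eval _).const_mul γ).pow_const 2)
  have ham : Measurable a := ((measurable_noiseCellEnergy hτ'.le).div_const _).const_add _
  have hgm : Measurable g := (hHm.const_mul _).const_add _
  have hH'm : Measurable H' := (measurable_ouCellEnergy hτ'.le).add
    ((measurable_ouVar.comp (measurable_shift_apply _)).pow_const 2)
  have hHi : Integrable H P := by
    refine (hP.integrable_noiseCellEnergy hτ'.le).1.add ?_
    simp only [mul_pow]
    exact (hP.integrable_sq_apply _).1.const_mul _
  have hH'i : Integrable H' P := (hP.integrable_ouCellEnergy hlam hτ'.le).add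
    ((hP.measurePreserving_shift τ).integrable_comp_of_integrable (hP.integrable_ouVar_sq hlam))
  have hgrow : ∀ {X : PathSpace → ℝ}, Measurable X → Integrable X P → 0 ≤ X → ∀ᵐ ω ∂P,
      Tendsto (fun n : ℕ => X (shift (-((n + 1) * τ)) ω) / n) atTop (𝓝 0) := fun hXm hX hX0 =>
    ae_tendsto_comp_div_atTop_zero (T := fun n => shift (-((n + 1) * τ)))
      (fun n => hP.measurePreserving_shift _) hXm hX hX0
  have hHg := hgrow hHm hHi fun ω => add_nonneg (noiseCellEnergy_nonneg hτ'.le ω) (sq_nonneg _)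
  have hH'g := hgrow hH'm hH'i fun ω => add_nonneg (ouCellEnergy_nonneg hτ'.le ω) (sq_nonneg _)
  have hYi := hP.integrable_noiseCellEnergy (γ := γ) hτ'.le
  have hai : Integrable a P := (integrable_const _).add (hYi.1.div_const _)
  have haE : ∫ ω, a ω ∂P < 0 := by
    have e : ∫ ω, a ω ∂P = -(κ * τ / 4) + γ ^ 2 * τ ^ 2 / 2 / (2 * κ) := by
      rw [ha, integral_add (integrable_const _) (hYi.1.div_const _), integral_div, hYi.2]
      simp
    have e1 : γ ^ 2 * (τ : ℝ) ^ 2 / 2 / (2 * κ) ≤ κ * τ / 8 := by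
      rw [div_div, div_le_div_iff₀ (by positivity) (by norm_num)]
      nlinarith
    have : 0 < κ * τ := by positivity
    rw [e]
    linarith
  have hLLN := hP.ae_tendsto_sum_comp_shift_div hτ'.le ham hai fun ω ω' hω => by
    simp only [ha, noiseCellEnergy_congr hτ'.le hω]
  set r := stationaryRadius τ a g with hr
  have hr0 : ∀ ω, 0 ≤ r ω := stationaryRadius_nonneg
  set b := randomBall γ lam (σ + ρ) r with hb
  have hsum : ∀ᵐ ω ∂P, Summable fun n => Real.exp (recursionTerm τ a g n ω) := by
    filter_upwards [hLLN, hHg] with ω h1 h2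
    exact summable_exp_of_tendsto_div haE
      (tendsto_recursionTerm_div h1 (tendsto_const_add_mul_div C₀ C₁ h2))
  have hstep : ∀ (ω : PathSpace) v, OUIntegrable lam ω →
      lorenzEnergy (σ + ρ - ouVar γ lam (shift τ ω)) (φ τ ω v) ≤
        Real.exp (a ω) * lorenzEnergy (σ + ρ - ouVar γ lam ω) v + (Real.exp (g ω) - 1) :=
    fun ω v hω => by
      have := hcell ω (lorenzFlow σ β ρ lam (ouPath γ hlam ω) v) hω
        (isLorenzTrajectory_lorenzFlow hσ hβ _ _ _)
      rwa [lorenzFlow_zero hσ hβ] at this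
  refine hRDS.exists_isPullbackAttractor (b := b) (0 : EuclideanSpace ℝ (Fin 3)) hτ
    continuous_randomBall (measurable_randomBall (measurable_stationaryRadius ham hgm)) ?_ ?_
  · filter_upwards [hsum, hP.ae_ouIntegrable hlam] with ω h1 h2 d
    rw [hb, mem_range_randomBall (hr0 _)]
    refine (hstep ω _ h2).trans ?_
    rw [hr, stationaryRadius_shift h1]
    have h3 := (mem_range_randomBall (γ := γ) (lam := lam) (c := σ + ρ) (hr0 ω)).1
      (mem_range_self d)
    have h4 := mul_le_mul_of_nonneg_left h3 (Real.exp_pos (a ω)).le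
    linarith
  · intro B hB
    obtain ⟨m, hm⟩ := hB.isBounded.exists_norm_le
    obtain ⟨D₀, D₁, hpart⟩ := exists_partial_cell_energy_le hκ hκσ hκ1 hκβ ρ lam τ m
    filter_upwards [hsum, hP.ae_ouIntegrable hlam, hLLN, hH'g] with ω h1 h2 h3 h4
    have h5 : Tendsto (fun n => Real.exp (recursionTerm τ a (fun ω => D₀ + D₁ * H' ω) n ω)) atTop
        (𝓝 0) := (summable_exp_of_tendsto_div haE (tendsto_recursionTerm_div h3
          (tendsto_const_add_mul_div D₀ D₁ h4))).tendsto_atTop_zero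
    have hfloor : Tendsto (fun t : ℝ≥0 => ⌊t / τ⌋₊) atTop atTop :=
      tendsto_nat_floor_atTop.comp (tendsto_id.atTop_div_const hτ)
    filter_upwards [hfloor.eventually (h5.eventually (gt_mem_nhds one_pos)),
      hfloor.eventually (eventually_ge_atTop 1)] with t ht1 ht2 v hv
    set n := ⌊t / τ⌋₊ with hn
    -- Starting at time `-t`, an incomplete cell of length `s` is crossed first, with a crude bound
    -- controlled by the full cell from `-(n + 1)τ` to `-nτ`; then `n` complete cells follow.
    obtain ⟨s, hs⟩ : ∃ s, t = n * τ + s := by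
      refine ⟨t - n * τ, (add_tsub_cancel_of_le ?_).symm⟩
      exact (le_div_iff₀ hτ).1 (Nat.floor_le zero_le)
    have hsτ : s ≤ τ := by
      have h6 : t < (n + 1) * τ := (div_lt_iff₀ hτ).1 (Nat.lt_floor_add_one _)
      rw [hs, add_mul, one_mul] at h6
      exact (lt_of_add_lt_add_left h6).le
    have hs' : (t : ℝ) = n * τ + s := by rw [hs]; push_cast; rfl
    have hsI : (s : ℝ) ∈ Icc (0 : ℝ) τ := ⟨s.2, hsτ⟩
    set w := φ s (shift (-t) ω) v with hw
    have e1 : φ t (shift (-t) ω) v = φ (n * τ) (shift (-(n * τ)) ω) w := by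
      conv_lhs => rw [hs]
      rw [hRDS.cocycle, ← shift_add, ← hs, hs']
      rw [hw, hs']
      ring_nf
    have hWw : lorenzEnergy (σ + ρ - ouVar γ lam (shift (-(n * τ)) ω)) w ≤
        Real.exp (D₀ + D₁ * H' (shift (-((n + 1) * τ)) ω)) := by
      have e2 : ∀ x : ℝ, ouPath γ hlam (shift (-t) ω) x =
          ouPath γ hlam (shift (-((n + 1) * τ)) ω) (x + (τ - s)) := fun x => by
        rw [ouPath_shift, ouPath_shift, hs']
        ring_nf
      have e3 : ouPath γ hlam (shift (-t) ω) s = ouVar γ lam (shift (-(n * τ)) ω) := by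
        rw [ouPath_apply, ← shift_add, hs']
        ring_nf
      have h6 := hpart (ouPath γ hlam (shift (-t) ω))
        (lorenzFlow σ β ρ lam (ouPath γ hlam (shift (-t) ω)) v) s
        (ouCellEnergy γ lam τ (shift (-((n + 1) * τ)) ω)) (ouPath γ hlam _).continuous hsI
        (isLorenzTrajectory_lorenzFlow hσ hβ _ _ _)
        (by rw [lorenzFlow_zero hσ hβ]; exact hm v hv)
        (by
          simp only [e2]
          exact integral_sq_comp_add_le (ouPath γ hlam (shift (-((n + 1) * τ)) ω)).continuous hsI)
      rw [e3] at h6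
      have e4 : shift τ (shift (-((n + 1) * τ)) ω) = shift (-(n * τ)) ω := by
        rw [← shift_add]
        ring_nf
      rw [hH']
      simp only
      rw [e4]
      exact h6
    rw [e1, hb, mem_range_randomBall (hr0 _)]
    refine (hRDS.le_of_step_le (a := a) (g := g)
      (V := fun ω v => lorenzEnergy (σ + ρ - ouVar γ lam ω) v) (fun k v => ?_) n w).trans ?_
    · have h6 := hstep (shift (-((k + 1) * τ)) ω) v (h2.shift hlam _)
      rw [← shift_add, show ((τ : ℝ) + -((k + 1) * τ)) = -(k * τ) by ring] at h6
      exact h6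
    · have h6 := mul_le_mul_of_nonneg_left hWw
        (Real.exp_pos (∑ i ∈ Finset.range n, a (shift (-((i + 1) * τ)) ω))).le
      rw [← Real.exp_add] at h6
      have h7 : Real.exp ((∑ i ∈ Finset.range n, a (shift (-((i + 1) * τ)) ω))
        + (D₀ + D₁ * H' (shift (-((n + 1) * τ)) ω))) < 1 := ht1
      rw [Finset.sum_sub_distrib]
      have h8 : ∑ j ∈ Finset.range n, Real.exp (recursionTerm τ a g j ω) ≤ r ω :=
        h1.sum_le_tsum _ fun _ _ => (Real.exp_pos _).le
      -- The slack terms sum to at least `1`, already by the term `j = 0`, which is why `n ≥ 1` is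
      -- required. They outweigh the initial contribution, which is eventually below `1`.
      have h9 : 1 ≤ ∑ j ∈ Finset.range n,
          Real.exp (∑ i ∈ Finset.range j, a (shift (-((i + 1) * τ)) ω)) := by
        have := Finset.single_le_sum (f := fun j =>
          Real.exp (∑ i ∈ Finset.range j, a (shift (-((i + 1) * τ)) ω)))
          (fun _ _ => (Real.exp_pos _).le) (Finset.mem_range.2 ht2)
        simpa using this
      linarith

end AbsorbingBall

/-- The transformed random Lorenz system has unique global solutions, these form a random dynamical
system over the Wiener shift, and it has a pullback attractor, unique up to null sets. -/
theorem lemma4p3p1 (P : Measure PathSpace) (hP : IsWienerMeasure P)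
    (γ ρ β σ lam : ℝ) (hβ : 0 < β) (hσ : 0 < σ) (hlam : 0 < lam) :
    ∃ φ : ℝ≥0 → PathSpace → EuclideanSpace ℝ (Fin 3) → EuclideanSpace ℝ (Fin 3),
      IsLorenzSolutionMap σ β ρ γ lam φ ∧
      (∀ φ', IsLorenzSolutionMap σ β ρ γ lam φ' → φ' = φ) ∧
      IsRDS P PathSpace.shift φ ∧
      ∃ A : PathSpace → Set (EuclideanSpace ℝ (Fin 3)),
        IsPullbackAttractor P PathSpace.shift φ A ∧
        ∀ A' : PathSpace → Set (EuclideanSpace ℝ (Fin 3)),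
          IsPullbackAttractor P PathSpace.shift φ A' → ∀ᵐ ω ∂P, A' ω = A ω := by
  have hRDS := isRDS_lorenzSolutionMap (ρ := ρ) (γ := γ) hP hσ hβ hlam
  obtain ⟨A, hA⟩ := exists_isPullbackAttractor_lorenzSolutionMap (ρ := ρ) (γ := γ) hP hσ hβ hlam
  exact ⟨lorenzSolutionMap σ β ρ γ hlam, isLorenzSolutionMap_lorenzSolutionMap hσ hβ hlam,
    fun φ' h => h.eq_lorenzSolutionMap hσ hβ hlam, hRDS, A, hA,
    fun A' hA' => hA.ae_eq hRDS 0 hA'⟩
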